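/- **Environment.** The state $\omega$ is drawn from a Borel probability measure $\mu$ on a compact interval $[\underline\omega,\bar\omega]$ whose support contains $\underline\omega$. The buyers' common value $v_B$ and the seller's reservation value $v_S$ are continuous functions of the state, $v_B$ is strictly increasing, and the surplus $v=v_B-v_S$ is strictly negative below, zero at, and strictly positive above some $\omega_0\in(\underline\omega,\bar\omega)$. The seller privately observes a type $y\in[\underline y,\bar y]$ (with $\underline y<\bar y$) with conditional density $g(y|\omega)$, continuous in $(y,\omega)$ and positive for $y\in(\underline y,\bar y)$; $G(\cdot|\omega)$ is the corresponding distribution. Buyers arrive, unobserved, at Poisson rate $\lambda>0$; given $(y,\omega)$, buyers' signals are i.i.d. with full-support probability mass function $f(\cdot|y,\omega)$, continuous in $(y,\omega)$, on a finite set $X\subset\mathbb R$ with $|X|\ge2$ and $\bar x=\max X$. The product $g(y|\omega)f(x|y,\omega)$ is log-supermodular in $(x,y,\omega)$, strictly in $(x,\omega)$ and in $(y,\omega)$, and $\limsup_{y\to\bar y}\int v(\omega)g(y|\omega)f(\bar x|y,\omega)\,d\mu(\omega)>0$. At each time $t\ge 0$ the seller, as a measurable function of $t$, $y$ and a uniform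 randomization device $z \in [0,1]$, decides whether to offer the good, at which price in $[\min v_B,\max v_B]$, and which message to send from a nonempty measurable space $M$. An arriving buyer observes only their own signal, the price and the message, and accepts with a probability that is a measurable function of these. Trade at price $p$ in state $\omega$ ends the game and gives $p-v_S(\omega)$ to the seller and $v_B(\omega)-p$ to the trading buyer; all other payoffs are $0$. A buyer's arrival time is uniform on $[0,\bar H]$ and payoffs are evaluated in the limit $\bar H\to\infty$. An equilibrium is a strategy profile in which the seller's strategy maximizes the seller's ex-ante expected utility given the buyers' strategy, and the buyers' strategy maximizes an individual buyer's expected payoff given the profile. Let $\tau$ be the first arrival time of a buyer with signal $\bar x$; given $(y,\omega)$ it is exponential with rate $\lambda f(\bar x|y,\omega)$. $\mathbb E$ refers to the joint law of $(\tau,y,\omega)$, and $\mathbb E[\,\cdot\,|\tau=t,y=y']$ is given by Bayes' rule for densities. **Proposition.** Assume (1) $f(x|y,\omega)=f(x|\omega)$ does not depend on $y$; (2) $v_S$ is strictly decreasing; (3) $\mathbb E[v_B(\omega)]<\max_{[\underline\omega,\bar\omega]}v_S$; (4) $g$ has no zero on $[\underline y,\bar y]\times[\underline\omega,\bar\omega]$.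 Then there exist a price $p^*$, exit times $s^*:[\underline y,\bar y]\to\mathbb R_+$ and an equilibrium such that: 1. At every time $t\ge0$, every type $y\in[\underline y,\bar y]$ offers the good if and only if $t\le s^*(y)$, and then at price $p^*$; all types send the same message at all times. The function $s^*$ is not identically zero, continuous, weakly increasing, and strictly increasing where non-zero (if $y<y'$ and $s^*(y)\neq0$ then $s^*(y)<s^*(y')$). 2. The price $p^*$ is accepted for signal $x$ if and only if $x=\bar x$. Prices strictly above $p^*$ are never accepted. Whatever the message, a price is accepted for signal $x$ if and only if it is weakly less than $$\frac{\int_{[\underline\omega,\bar\omega]}\int_{(\underline y,\bar y)}\int_{\mathbb R_+}v_B(\omega)f(x|\omega)e^{-\lambda f(\bar x|\omega)t}\mathbf 1(t\le s^*(y))\,dt\,dG(y|\omega)\,d\mu(\omega)}{\int_{[\underline\omega,\bar\omega]}\int_{(\underline y,\bar y)}\int_{\mathbb R_+}f(x|\omega)e^{-\lambda f(\bar x|\omega)t}\mathbf 1(t\le s^*(y))\,dt\,dG(y|\omega)\,d\mu(\omega)}.$$ (Here "accepted" means with probability one and "not accepted" means with probability zero.) Moreover $p^*=\mathbb E[v_B(\omega)\,|\,\tau\le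 s^*(y)]$, where the condition is that an $\bar x$-buyer arrives no later than the exit time of the realized type, and for every type $y'\in[\underline y,\bar y]$, $$s^*(y')=\min\{r\in\mathbb R_+:\ \mathbb E[p^*-v_S(\omega)\,|\,\tau=r,\,y=y']\le0\}.$$ -/

import Mathlib

open MeasureTheory Filter Topology
open scoped NNReal ENNReal

noncomputable section

/-- Lebesgue measure on a compact interval. -/
def lebesgueOn (a b : ℝ) : Measure (Set.Icc a b) :=
  Measure.comap Subtype.val (volume : Measure ℝ)

/-- The environment: a lemons market with a privately informed seller and buyers who arrive over
time with private signals. States lie in `[ωLo, ωHi]`, the seller's types in `[yLo, yHi]`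
(assumptions on the density of the type that concern its sign or strictness are imposed on
interior types only), buyers' signals in the finite set `X`. -/
structure Market where
  /-- lowest and highest state -/
  ωLo : ℝ
  ωHi : ℝ
  /-- lowest and highest type of the seller -/
  yLo : ℝ
  yHi : ℝ
  yLo_lt_yHi : yLo < yHi
  /-- the finite set of buyers' signals -/
  X : Finset ℝ
  two_le_card : 2 ≤ X.card
  /-- prior distribution of the state -/
  μ : Measure (Set.Icc ωLo ωHi)
  isProb : IsProbabilityMeasure μ
  /-- buyers' common value and the seller's reservation value -/
  vB : Set.Icc ωLo ωHi → ℝ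
  vS : Set.Icc ωLo ωHi → ℝ
  vB_continuous : Continuous vB
  vS_continuous : Continuous vS
  vB_strictMono : StrictMono vB
  /-- the surplus `vB - vS` strictly single-crosses zero from below at an interior state -/
  singleCrossing : ∃ ω₀ : Set.Icc ωLo ωHi, ωLo < ω₀ ∧ (ω₀ : ℝ) < ωHi ∧ vB ω₀ - vS ω₀ = 0 ∧
    (∀ ω, ω < ω₀ → vB ω - vS ω < 0) ∧ (∀ ω, ω₀ < ω → 0 < vB ω - vS ω)
  /-- `g y ω` is the density of the seller's type at `y` in state `ω` -/
  g : Set.Icc yLo yHi → Set.Icc ωLo ωHi → ℝ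
  g_continuous : Continuous (fun w : Set.Icc yLo yHi × Set.Icc ωLo ωHi => g w.1 w.2)
  g_pos : ∀ (y : Set.Icc yLo yHi) ω, yLo < (y : ℝ) → (y : ℝ) < yHi → 0 < g y ω
  g_integral : ∀ ω, ∫ y, g y ω ∂(lebesgueOn yLo yHi) = 1
  /-- `f x y ω` is the probability of the buyer signal `x` given type `y` and state `ω` -/
  f : X → Set.Icc yLo yHi → Set.Icc ωLo ωHi → ℝ
  f_continuous : ∀ x, Continuous (fun w : Set.Icc yLo yHi × Set.Icc ωLo ωHi => f x w.1 w.2)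
  f_pos : ∀ x y ω, 0 < f x y ω
  f_sum : ∀ y ω, ∑ x, f x y ω = 1
  /-- `g f` is log-supermodular in signal, type and state -/
  logSupermodular : ∀ x x' y y' ω ω',
    g y ω * f x y ω * (g y' ω' * f x' y' ω') ≤
      g (max y y') (max ω ω') * f (max x x') (max y y') (max ω ω') *
        (g (min y y') (min ω ω') * f (min x x') (min y y') (min ω ω'))
  /-- strictly so in signal and state -/
  strict_signal_state : ∀ y x x' ω ω', x' < x → ω' < ω →
    f x y ω' * f x' y ω < f x y ω * f x' y ω'
  /-- strictly so in type and state -/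
  strict_type_state : ∀ x (y y' : Set.Icc yLo yHi) ω ω', yLo < (y' : ℝ) → (y : ℝ) < yHi → y' < y → ω' < ω →
    (g y ω' * f x y ω') * (g y' ω * f x y' ω) < (g y ω * f x y ω) * (g y' ω' * f x y' ω')
  /-- Poisson arrival rate of buyers -/
  rate : ℝ
  rate_pos : 0 < rate

namespace Market

/-- The space of states. -/
abbrev State (E : Market) : Type := Set.Icc E.ωLo E.ωHi

/-- The space of types of the seller. -/
abbrev SellerType (E : Market) : Type := Set.Icc E.yLo E.yHi

/-- Lebesgue measure on the type space. -/
abbrev typeVolume (E : Market) : Measure E.SellerType := lebesgueOn E.yLo E.yHi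

/-- The interval of feasible prices, `[min vB, max vB]`. -/
abbrev Price (E : Market) : Type := Set.Icc (⨅ ω, E.vB ω) (⨆ ω, E.vB ω)

variable (E : Market)

theorem X_nonempty : E.X.Nonempty :=
  Finset.card_pos.mp (lt_of_lt_of_le two_pos E.two_le_card)

/-- The highest signal `x̄`. -/
def xbar : E.X := ⟨E.X.max' E.X_nonempty, E.X.max'_mem E.X_nonempty⟩

/-- Trade is possible: `limsup_{y → yHi} ∫ v(ω) g(y|ω) f(x̄|y,ω) dμ(ω) > 0`. -/
def TradeIsPossible : Prop :=
  (0 : EReal) < limsup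
    (fun y : E.SellerType =>
      ((∫ ω, (E.vB ω - E.vS ω) * E.g y ω * E.f E.xbar y ω ∂E.μ : ℝ) : EReal))
    (comap (fun y : E.SellerType => (y : ℝ)) (𝓝[<] E.yHi))

/-- The lowest state `ωLo` belongs to the support of the prior. -/
def LowestStateInSupport : Prop := ∀ ω : E.State, (ω : ℝ) = E.ωLo → ω ∈ E.μ.support

/-- The regularity condition for equilibrium. -/
structure Regular : Prop where
  /-- the seller's type and the buyers' signals are independent conditional on the state -/
  condIndep : ∀ x y y' ω, E.f x y ω = E.f x y' ω
  vS_strictAnti : StrictAnti E.vS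
  mean_lt_max : ∫ ω, E.vB ω ∂E.μ < ⨆ ω, E.vS ω
  /-- bounded informativeness: the density `g` has no zero, also at the end points of the
  (compact) type space -/
  bounded : ∀ y ω, E.g y ω ≠ 0

/-! ### Strategies, payoffs and equilibrium -/

/-- A (behaviour) strategy of the buyers: `accept (x, p, m)` is the probability with which a buyer
with signal `x` accepts the price `p` upon seeing the message `m`. -/
structure BuyerStrategy (M : Type*) [MeasurableSpace M] where
  accept : E.X × E.Price × M → unitInterval
  measurable_accept : Measurable accept

/-- A strategy of the seller, depending on time, type and a randomization device that is uniform
on `[0,1]`: whether to offer the good, the price, and the message. Values at negative times are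
irrelevant. -/
structure SellerStrategy (M : Type*) [MeasurableSpace M] where
  offer : ℝ × E.SellerType × unitInterval → Bool
  price : ℝ × E.SellerType × unitInterval → E.Price
  message : ℝ × E.SellerType × unitInterval → M
  measurable_offer : Measurable offer
  measurable_price : Measurable price
  measurable_message : Measurable message

section Strategies

variable {E} {M : Type*} [MeasurableSpace M]

/-- The probability with which a buyer who arrives at time `t` is offered the good and accepts
it, given type, randomization device and state. -/
def acceptProb (α : E.BuyerStrategy M) (s : E.SellerStrategy M)
    (t : ℝ) (y : E.SellerType) (z : unitInterval) (ω : E.State) : ℝ :=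
  (if s.offer (t, y, z) = true then 1 else 0) *
    ∑ x, E.f x y ω * (α.accept (x, s.price (t, y, z), s.message (t, y, z)) : ℝ)

/-- The Poisson rate `q_σ` at which trade happens. -/
def tradeRate (α : E.BuyerStrategy M) (s : E.SellerStrategy M)
    (t : ℝ) (y : E.SellerType) (z : unitInterval) (ω : E.State) : ℝ :=
  E.rate * acceptProb α s t y z ω

/-- The probability that the good is still available at time `t`. -/
def survival (α : E.BuyerStrategy M) (s : E.SellerStrategy M)
    (t : ℝ) (y : E.SellerType) (z : unitInterval) (ω : E.State) : ℝ :=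
  Real.exp (-∫ r in (0 : ℝ)..t, tradeRate α s r y z ω)

/-- Expected utility of the seller when the time horizon is `H`. -/
def sellerPayoff (α : E.BuyerStrategy M) (s : E.SellerStrategy M) (H : ℝ) : ℝ :=
  ∫ ω, ∫ y, (∫ z : unitInterval, ∫ t in (0 : ℝ)..H,
    ((s.price (t, y, z) : ℝ) - E.vS ω) * tradeRate α s t y z ω * survival α s t y z ω) * E.g y ω
    ∂E.typeVolume ∂E.μ

/-- `u` is the expected utility of the seller with an unbounded time horizon: the limit of the
utilities with horizon `H`, as `H → ∞`. -/
def IsSellerUtility (α : E.BuyerStrategy M) (s : E.SellerStrategy M) (u : ℝ) : Prop :=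
  Tendsto (fun H => sellerPayoff α s H) atTop (𝓝 u)

/-- Expected payoff (up to the constant factor `1 / H`) of an individual buyer, whose arrival time
is uniform on `[0, H]`, if this buyer accepts according to `α'` and everybody else follows
`(α, s)`. -/
def buyerPayoff (α : E.BuyerStrategy M) (s : E.SellerStrategy M) (α' : E.BuyerStrategy M)
    (H : ℝ) : ℝ :=
  ∫ ω, ∫ y, (∫ z : unitInterval, ∫ t in (0 : ℝ)..H,
    (E.vB ω - (s.price (t, y, z) : ℝ)) * acceptProb α' s t y z ω * survival α s t y z ω) * E.g y ω
    ∂E.typeVolume ∂E.μ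

/-- The seller's strategy is a best reply: it maximizes the seller's utility across all strategies
of the seller. -/
def SellerBestReply (α : E.BuyerStrategy M) (s : E.SellerStrategy M) : Prop :=
  ∃ u, IsSellerUtility α s u ∧
    ∀ s' : E.SellerStrategy M, ∃ u', IsSellerUtility α s' u' ∧ u' ≤ u

/-- The buyers' strategy is a best reply in the limit of an unbounded time horizon: no strategy
of an individual buyer yields an asymptotically higher payoff than `α`. -/
def BuyerBestReply (α : E.BuyerStrategy M) (s : E.SellerStrategy M) : Prop :=
  ∀ α' : E.BuyerStrategy M, ∀ ε > 0, ∀ᶠ H in atTop,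
    buyerPayoff α s α' H ≤ buyerPayoff α s α H + ε

/-- Equilibrium: both sides are best replying. -/
def IsEquilibrium (α : E.BuyerStrategy M) (s : E.SellerStrategy M) : Prop :=
  SellerBestReply α s ∧ BuyerBestReply α s

end Strategies

/-! ### The joint law of state, type and first arrival of an `x̄`-buyer -/

/-- Joint density of type and first arrival time `τ` of an `x̄`-buyer in state `ω`: the type has
density `g(·|ω)`, and given type `y` the time `τ` is exponential with rate `λ f(x̄|y,ω)`. -/
def density (t : ℝ) (y : E.SellerType) (ω : E.State) : ℝ :=
  E.g y ω * (if 0 ≤ t then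
    E.rate * E.f E.xbar y ω * Real.exp (-(E.rate * E.f E.xbar y ω * t)) else 0)

/-- The joint law of `(ω, y, τ)`. -/
def jointLaw : Measure (E.State × E.SellerType × ℝ) :=
  (E.μ.prod (E.typeVolume.prod (volume : Measure ℝ))).withDensity
    (fun w => ENNReal.ofReal (E.density w.2.2 w.2.1 w.1))

/-- `E[φ(ω) | τ ≤ s(y)]`, the expectation conditional on the event that an `x̄`-buyer arrives
before the exit time. -/
def meanGivenTrade (φ : E.State → ℝ) (s : E.SellerType → ℝ≥0) : ℝ :=
  ∫ w, φ w.1 ∂(ProbabilityTheory.cond E.jointLaw {w | w.2.2 ≤ (s w.2.1 : ℝ)})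

/-- `E[φ(ω) | τ = t, y = y]`, by Bayes' rule for densities. -/
def meanGivenTimeType (φ : E.State → ℝ) (t : ℝ) (y : E.SellerType) : ℝ :=
  (∫ ω, φ ω * E.density t y ω ∂E.μ) / ∫ ω, E.density t y ω ∂E.μ

/-- The posterior value under passive beliefs of a buyer with signal `x` who infers to have arrived
at a time `t ≤ s(y)` before the arrival of the first `x̄`-buyer. -/
def passiveValue (s : E.SellerType → ℝ≥0) (x : E.X) : ℝ :=
  (∫ ω, ∫ y, (∫ t in Set.Ici (0 : ℝ), E.vB ω * E.f x y ω *
      Real.exp (-(E.rate * E.f E.xbar y ω * t)) * (if t ≤ (s y : ℝ) then 1 else 0)) * E.g y ω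
      ∂E.typeVolume ∂E.μ) /
    ∫ ω, ∫ y, (∫ t in Set.Ici (0 : ℝ), E.f x y ω *
      Real.exp (-(E.rate * E.f E.xbar y ω * t)) * (if t ≤ (s y : ℝ) then 1 else 0)) * E.g y ω
      ∂E.typeVolume ∂E.μ

end Market

end

/-! ### Auxiliary analysis -/

/-! Suppose that only buyers with the highest signal trade, at a single price `p`. The margin `p -
vS` increases in the state, and so does the arrival rate `hazard` of these buyers. A later time
without trade is therefore bad news for the seller, while a higher type is good news. Reweighting a
strictly increasing function by a strictly increasing likelihood ratio can only push its mean
upwards through zero (`integral_mul_pos_of_strictMono`). Hence the posterior margin `gain` crosses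
zero at most once in time, from above, and at most once in type, from below. For `p` below the
highest reservation value, long waiting concentrates the posterior near the lowest state, so the
crossing time `exitTime` is finite; it is continuous in price and type and increases in the type.

The price solves the fixed-point equation `p = E[vB | trade]`, by the intermediate value theorem.
Just above the price at which the highest type is indifferent at time zero, trade involves only
types near the top and times near zero, and possibility of trade makes the buyers' value exceed the
price (`exists_price_le_value`). Close to the highest reservation value, all types sell almost
surely, so the value is close to the prior mean, which is lower than the price
(`exists_value_le_price`).

At the fixed point a buyer with the highest signal just breaks even, and by the monotone likelihood
ratio every other signal gives a strictly lower value (`passiveValue_lt`). Acceptance below the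
passive-beliefs value is therefore a best reply.

For the seller, prices above `p` never sell, so a deviation earns at most what its trade
probabilities would earn at price `p`. Relative to `hazard`, its total hazard falls with the state
(`totalHazard_ratio`). It is dominated by serving only highest-signal buyers up to a time `R` chosen
to match total hazards at the break-even state (`integral_sellerValue_le`). Among such stopping
times `exitTime` is optimal, since payoff differences are integrals of `gain` (`stopping_optimal`).
-/

theorem Continuous.integrable_of_compactSpace {Ω : Type*} [TopologicalSpace Ω] [CompactSpace Ω]
    [MeasurableSpace Ω] [OpensMeasurableSpace Ω] {μ : Measure Ω}
    [IsFiniteMeasure μ] {f : Ω → ℝ} (hf : Continuous f) : Integrable f μ :=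
  hf.integrable_of_hasCompactSupport (HasCompactSupport.of_compactSpace f)

theorem continuous_integral_of_compactSpace {X Ω : Type*} [TopologicalSpace X]
    [FirstCountableTopology X] [LocallyCompactSpace X] [TopologicalSpace Ω] [CompactSpace Ω]
    [MeasurableSpace Ω] [OpensMeasurableSpace Ω] {μ : Measure Ω} [IsFiniteMeasure μ]
    {f : X → Ω → ℝ} (hf : Continuous (Function.uncurry f)) : Continuous (fun x => ∫ ω, f x ω ∂μ) := by
  simpa using continuous_parametric_integral_of_continuous (μ := μ) hf isCompact_univ

/-- The fundamental theorem of calculus for the survival function with a bounded measurable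
hazard rate. -/
theorem integral_hazard_mul_survival {q : ℝ → ℝ} (hq : Measurable q) {C : ℝ}
    (h0 : ∀ t, 0 ≤ q t) (hC : ∀ t, q t ≤ C) (H : ℝ) :
    ∫ t in (0 : ℝ)..H, q t * Real.exp (-∫ r in (0 : ℝ)..t, q r)
      = 1 - Real.exp (-∫ r in (0 : ℝ)..H, q r) := by
  have hbd : ∀ t, ‖q t‖ ≤ C := fun t => by
    rw [Real.norm_of_nonneg (h0 t)]; exact hC t
  have hloc : LocallyIntegrable q volume :=
    (locallyIntegrable_const C).mono hq.aestronglyMeasurable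
      (Eventually.of_forall fun t => by
        rw [Real.norm_of_nonneg ((h0 t).trans (hC t))]; exact hbd t)
  have hint : ∀ a b, IntervalIntegrable q volume a b := fun a b =>
    (hloc.integrableOn_isCompact isCompact_uIcc).intervalIntegrable
  -- The hazard is merely measurable, so the survival function is differentiable only almost
  -- everywhere. Integrating its derivative requires absolute continuity, obtained from a Lipschitz
  -- exponent and the Lipschitz property of the exponential on the bounded range of that exponent.
  have hlip : LipschitzWith C.toNNReal (fun t => ∫ r in (0 : ℝ)..t, q r) := by
    refine LipschitzWith.of_dist_le_mul fun a b => ?_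
    rw [Real.dist_eq, intervalIntegral.integral_interval_sub_left (hint _ _) (hint _ _),
      Real.dist_eq, Real.coe_toNNReal _ ((h0 0).trans (hC 0))]
    simpa using intervalIntegral.norm_integral_le_of_norm_le_const (a := b) (b := a)
      (f := q) (C := C) (fun t _ => hbd t)
  have hexp : ContDiff ℝ 1 (fun x : ℝ => Real.exp (-x)) := by fun_prop
  obtain ⟨B, hB⟩ : ∃ B, ∀ t ∈ Set.uIcc 0 H, |∫ r in (0 : ℝ)..t, q r| ≤ B := by
    obtain ⟨B, hB⟩ := (isCompact_uIcc (a := (0 : ℝ)) (b := H)).exists_bound_of_continuousOn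
      hlip.continuous.continuousOn
    exact ⟨B, hB⟩
  obtain ⟨K, hK⟩ := (hexp.contDiffOn (s := Set.Icc (-B) B)).exists_lipschitzOnWith one_ne_zero
    (convex_Icc _ _) isCompact_Icc
  have hac : AbsolutelyContinuousOnInterval
      (fun t => Real.exp (-∫ r in (0 : ℝ)..t, q r)) 0 H :=
    (hK.comp (f := fun t => ∫ r in (0 : ℝ)..t, q r) hlip.lipschitzOnWith
      fun t ht => abs_le.mp (hB t ht)).absolutelyContinuousOnInterval
  have hF := hac.integral_deriv_eq_sub
  have hae : ∀ᵐ t, deriv (fun t => Real.exp (-∫ r in (0 : ℝ)..t, q r)) t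
      = -(q t * Real.exp (-∫ r in (0 : ℝ)..t, q r)) := by
    filter_upwards [LocallyIntegrable.ae_hasDerivAt_integral hloc] with t ht
    have := ((ht 0).neg.exp).deriv
    simp only [Pi.neg_apply] at this
    rw [this]; ring
  rw [intervalIntegral.integral_congr_ae (hae.mono fun t ht _ => ht),
    intervalIntegral.integral_neg] at hF
  simp at hF
  linarith

/-! ### Reweighting and single crossing -/

section SingleCrossing

variable {Ω : Type*} [TopologicalSpace Ω] [PreconnectedSpace Ω]

/-- The intermediate value theorem, in a form that serves both to find the break-even state of a
margin and to exclude sign changes of the density in the type. -/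
theorem forall_pos_or_forall_neg_or_exists_zero {φ : Ω → ℝ} (hφ : Continuous φ) :
    (∀ ω, 0 < φ ω) ∨ (∀ ω, φ ω < 0) ∨ ∃ ω, φ ω = 0 := by
  by_contra! h
  obtain ⟨⟨a, ha⟩, ⟨b, hb⟩, h0⟩ := h
  obtain ⟨ω, hω⟩ := mem_range_of_exists_le_of_exists_ge hφ ⟨a, ha⟩ ⟨b, hb⟩
  exact h0 ω hω

variable [LinearOrder Ω] [Nonempty Ω] [MeasurableSpace Ω] {μ : Measure Ω}

/-- Reweighting by a strictly increasing function preserves nonnegativity of the mean of a strictly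
increasing function, and makes it strict. -/
theorem integral_mul_pos_of_strictMono {φ w m : Ω → ℝ} (hφc : Continuous φ) (hφ : StrictMono φ)
    (hm : StrictMono m) (hm0 : ∀ ω, 0 < m ω) (hw : ∀ ω, 0 < w ω)
    (hi : Integrable (fun ω => φ ω * w ω) μ) (hi' : Integrable (fun ω => φ ω * (m ω * w ω)) μ)
    (hμ : ∀ ω, μ {ω}ᶜ ≠ 0) (h : 0 ≤ ∫ ω, φ ω * w ω ∂μ) :
    0 < ∫ ω, φ ω * (m ω * w ω) ∂μ := by
  obtain ⟨ω₁⟩ := ‹Nonempty Ω›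
  have huniv : 0 < μ Set.univ := (pos_iff_ne_zero.mpr (hμ ω₁)).trans_le (measure_mono (Set.subset_univ _))
  rcases forall_pos_or_forall_neg_or_exists_zero hφc with hp | hn | ⟨ω₀, h0⟩
  · have hpos : ∀ ω, 0 < φ ω * (m ω * w ω) := fun ω => mul_pos (hp ω) (mul_pos (hm0 ω) (hw ω))
    rw [integral_pos_iff_support_of_nonneg (fun ω => (hpos ω).le) hi',
      Function.support_eq_univ fun ω => (hpos ω).ne']
    exact huniv
  · exfalso
    have hpos : ∀ ω, 0 < -(φ ω * w ω) := fun ω => neg_pos.mpr (mul_neg_of_neg_of_pos (hn ω) (hw ω))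
    have : 0 < ∫ ω, -(φ ω * w ω) ∂μ := by
      rw [integral_pos_iff_support_of_nonneg (fun ω => (hpos ω).le) hi.neg,
        Function.support_eq_univ fun ω => (hpos ω).ne']
      exact huniv
    rw [integral_neg] at this
    linarith
  -- Compare `m` with its constant value at the zero `ω₀` of `φ`. Since `φ` and `m - m ω₀` have the
  -- same sign, the difference of the integrands is positive off `ω₀`, a set that is not null.
  · have key : 0 < ∫ ω, (φ ω * (m ω * w ω) - m ω₀ * (φ ω * w ω)) ∂μ := by
      have hne : ∀ ω, ω ≠ ω₀ → 0 < φ ω * (m ω * w ω) - m ω₀ * (φ ω * w ω) := by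
        intro ω hω
        have : φ ω * (m ω * w ω) - m ω₀ * (φ ω * w ω) = (φ ω * (m ω - m ω₀)) * w ω := by ring
        rw [this]
        refine mul_pos ?_ (hw ω)
        rcases lt_or_gt_of_ne hω with hlt | hgt
        · exact mul_pos_of_neg_of_neg (h0 ▸ hφ hlt) (sub_neg.mpr (hm hlt))
        · exact mul_pos (h0 ▸ hφ hgt) (sub_pos.mpr (hm hgt))
      rw [integral_pos_iff_support_of_nonneg _ (show Integrable (fun ω => φ ω * (m ω * w ω) - m ω₀ * (φ ω * w ω)) μ from
        hi'.sub (hi.const_mul _))]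
      · refine (pos_iff_ne_zero.mpr (hμ ω₀)).trans_le (measure_mono fun ω hω => ?_)
        exact (hne ω hω).ne'
      · intro ω
        by_cases hω : ω = ω₀
        · simp [hω, h0]
        · exact (hne ω hω).le
    have hsub := integral_sub hi' (hi.const_mul (m ω₀))
    rw [hsub, integral_const_mul] at key
    nlinarith [mul_nonneg (hm0 ω₀).le h]

end SingleCrossing

/-- Exponential discounting with a strictly increasing rate eventually selects the lowest states. -/
theorem exists_integral_mul_exp_nonpos {Ω : Type*} [TopologicalSpace Ω] [LinearOrder Ω]
    [OrderClosedTopology Ω]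
    [PreconnectedSpace Ω] [Nonempty Ω] [CompactSpace Ω] [MeasurableSpace Ω] [OpensMeasurableSpace Ω]
    {μ : Measure Ω} [IsFiniteMeasure μ] {φ w k : Ω → ℝ} (hφc : Continuous φ) (hφ : StrictMono φ)
    (hk : Continuous k) (hkm : StrictMono k) (hwc : Continuous w) (hw : ∀ ω, 0 < w ω)
    {ω₁ : Ω} (hneg : φ ω₁ < 0) (hμ : ∀ ω, ω₁ < ω → μ (Set.Iio ω) ≠ 0) :
    ∃ r : ℝ, 0 ≤ r ∧ ∫ ω, φ ω * (w ω * Real.exp (-(k ω * r))) ∂μ ≤ 0 := by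
  rcases forall_pos_or_forall_neg_or_exists_zero hφc with hp | hn | ⟨ω₀, h0⟩
  · exact absurd (hp ω₁) (not_lt.mpr hneg.le)
  · refine ⟨0, le_rfl, integral_nonpos fun ω => ?_⟩
    exact mul_nonpos_of_nonpos_of_nonneg (hn ω).le (mul_pos (hw ω) (Real.exp_pos _)).le
  have h1 : ω₁ < ω₀ := hφ.lt_iff_lt.mp (by rw [h0]; exact hneg)
  classical
  -- After rescaling by `exp (k ω₀ * r)`, the exponential vanishes in the limit above `ω₀` and is at
  -- least `1` below it. Replacing it by `1` below `ω₀`, where `φ` is negative, gives a bounded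
  -- integrand that dominates the rescaled one and has a strictly negative limit integral.
  let F : ℝ → Ω → ℝ := fun r ω =>
    φ ω * w ω * (if ω < ω₀ then 1 else Real.exp (-((k ω - k ω₀) * r)))
  have hlim : Tendsto (fun r => ∫ ω, F r ω ∂μ) atTop
      (𝓝 (∫ ω, φ ω * w ω * (if ω < ω₀ then 1 else 0) ∂μ)) := by
    refine tendsto_integral_filter_of_dominated_convergence (fun ω => |φ ω * w ω|) ?_ ?_ ?_ ?_
    · refine Eventually.of_forall fun r => ?_
      refine ((hφc.mul hwc).measurable.mul (Measurable.ite measurableSet_Iio measurable_const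
        ?_)).aestronglyMeasurable
      exact Continuous.measurable (by fun_prop)
    · filter_upwards [eventually_ge_atTop 0] with r hr
      refine Eventually.of_forall fun ω => ?_
      rw [norm_mul, Real.norm_eq_abs]
      refine mul_le_of_le_one_right (abs_nonneg _) ?_
      split_ifs with h
      · simp
      · rw [Real.norm_of_nonneg (Real.exp_pos _).le, Real.exp_le_one_iff]
        have := hkm.monotone (not_lt.mp h)
        nlinarith
    · exact ((hφc.mul hwc).abs).integrable_of_compactSpace
    · refine Eventually.of_forall fun ω => ?_
      by_cases h : ω < ω₀
      · simp only [F, h, if_true]; exact tendsto_const_nhds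
      · simp only [F, h, if_false]
        rcases eq_or_lt_of_le (not_lt.mp h) with rfl | hlt
        · simp [h0]
        · refine Tendsto.const_mul _ ?_
          refine Real.tendsto_exp_neg_atTop_nhds_zero.comp ?_
          exact tendsto_id.const_mul_atTop (sub_pos.mpr (hkm hlt))
  have hlneg : ∫ ω, φ ω * w ω * (if ω < ω₀ then 1 else 0) ∂μ < 0 := by
    have hint : Integrable (fun ω => -(φ ω * w ω * (if ω < ω₀ then 1 else 0))) μ := by
      refine Integrable.neg ?_
      refine ((hφc.mul hwc).integrable_of_compactSpace (μ := μ)).mul_bdd (c := 1) ?_ ?_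
      · exact (Measurable.ite measurableSet_Iio measurable_const
          measurable_const).aestronglyMeasurable
      · refine Eventually.of_forall fun ω => ?_
        split_ifs <;> simp
    have : 0 < ∫ ω, -(φ ω * w ω * (if ω < ω₀ then 1 else 0)) ∂μ := by
      rw [integral_pos_iff_support_of_nonneg _ hint]
      · refine (pos_iff_ne_zero.mpr (hμ ω₀ h1)).trans_le (measure_mono fun ω hω => ?_)
        have hω' : ω < ω₀ := hω
        simp only [Function.mem_support, hω', if_true, mul_one]
        exact neg_ne_zero.mpr (mul_neg_of_neg_of_pos (h0 ▸ hφ hω') (hw ω)).ne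
      · intro ω
        simp only [Pi.zero_apply]
        split_ifs with h
        · have := mul_neg_of_neg_of_pos (h0 ▸ hφ h : φ ω < 0) (hw ω)
          linarith
        · simp
    rw [integral_neg] at this
    linarith
  obtain ⟨r, hr, hr0⟩ := ((hlim.eventually_lt_const hlneg).and (eventually_ge_atTop 0)).exists
  refine ⟨r, hr0, ?_⟩
  have hle : ∫ ω, Real.exp (k ω₀ * r) * (φ ω * (w ω * Real.exp (-(k ω * r)))) ∂μ
      ≤ ∫ ω, F r ω ∂μ := by
    refine integral_mono ?_ ?_ fun ω => ?_
    · exact Continuous.integrable_of_compactSpace (by fun_prop)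
    · refine ((hφc.mul hwc).integrable_of_compactSpace (μ := μ)).mul_bdd (c := 1) ?_ ?_
      · refine (Measurable.ite measurableSet_Iio measurable_const ?_).aestronglyMeasurable
        exact Continuous.measurable (by fun_prop)
      · refine Eventually.of_forall fun ω => ?_
        split_ifs with h
        · simp
        · rw [Real.norm_of_nonneg (Real.exp_pos _).le, Real.exp_le_one_iff]
          have := hkm.monotone (not_lt.mp h)
          nlinarith
    · have hE : Real.exp (k ω₀ * r) * Real.exp (-(k ω * r)) = Real.exp (-((k ω - k ω₀) * r)) := by
        rw [← Real.exp_add]; ring_nf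
      have hE' : Real.exp (k ω₀ * r) * (φ ω * (w ω * Real.exp (-(k ω * r)))) =
          φ ω * w ω * Real.exp (-((k ω - k ω₀) * r)) := by rw [← hE]; ring
      simp only [F]
      rw [hE']
      split_ifs with h
      · have h1 := mul_neg_of_neg_of_pos (h0 ▸ hφ h : φ ω < 0) (hw ω)
        have h2 : 1 ≤ Real.exp (-((k ω - k ω₀) * r)) := by
          rw [Real.one_le_exp_iff]
          have := hkm h
          nlinarith
        nlinarith
      · exact le_rfl
  rw [integral_const_mul] at hle
  by_contra! hpos
  have := mul_pos (Real.exp_pos (k ω₀ * r)) hpos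
  linarith

/-- The integral over time of an exponentially decaying flow. -/
theorem intervalIntegral_integral_mul_exp {Ω : Type*} [TopologicalSpace Ω] [CompactSpace Ω]
    [SecondCountableTopology Ω] [MeasurableSpace Ω] [OpensMeasurableSpace Ω]
    {μ : Measure Ω} [IsFiniteMeasure μ] {ψ k : Ω → ℝ} (hψ : Continuous ψ) (hk : Continuous k)
    (a b : ℝ) :
    ∫ r in a..b, ∫ ω, ψ ω * (k ω * Real.exp (-(k ω * r))) ∂μ
      = ∫ ω, ψ ω * (Real.exp (-(k ω * a)) - Real.exp (-(k ω * b))) ∂μ := by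
  rw [intervalIntegral_integral_swap]
  · refine integral_congr_ae (Eventually.of_forall fun ω => ?_)
    have hd : ∀ r ∈ Set.uIcc a b, HasDerivAt (fun r => -(ψ ω * Real.exp (-(k ω * r))))
        (ψ ω * (k ω * Real.exp (-(k ω * r)))) r := by
      intro r _
      have h := ((((hasDerivAt_id r).const_mul (k ω)).neg).exp.const_mul (ψ ω)).neg
      convert! h using 1
      simp only [Pi.neg_apply, id]
      ring
    simp only
    rw [intervalIntegral.integral_eq_sub_of_hasDerivAt hd
      (Continuous.intervalIntegrable (by fun_prop) _ _)]
    ring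
  · have hc : Continuous (Function.uncurry fun (r : ℝ) (ω : Ω) =>
        ψ ω * (k ω * Real.exp (-(k ω * r)))) := by
      unfold Function.uncurry; fun_prop
    obtain ⟨C, hC⟩ := ((isCompact_uIcc (a := a) (b := b)).prod
      (isCompact_univ (X := Ω))).exists_bound_of_continuousOn hc.continuousOn
    have : IsFiniteMeasure ((volume : Measure ℝ).restrict (Set.uIoc a b)) := ⟨by simp [Set.uIoc]⟩
    refine Integrable.of_bound hc.aestronglyMeasurable C ?_
    have : ∀ᵐ z ∂(volume.restrict (Set.uIoc a b)).prod μ, z.1 ∈ Set.uIoc a b := by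
      have h := ae_restrict_mem (μ := (volume : Measure ℝ)) (measurableSet_uIoc (a := a) (b := b))
      exact Measure.quasiMeasurePreserving_fst.ae h
    filter_upwards [this] with z hz
    exact hC z ⟨Set.uIoc_subset_uIcc hz, Set.mem_univ _⟩

/-! ### Primitives of the market -/

theorem lebesgueOn_apply (a b : ℝ) (s : Set (Set.Icc a b)) :
    lebesgueOn a b s = volume (Subtype.val '' s) :=
  (MeasurableEmbedding.subtype_coe measurableSet_Icc).comap_apply _ _

instance isFiniteMeasure_lebesgueOn (a b : ℝ) : IsFiniteMeasure (lebesgueOn a b) := by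
  refine ⟨?_⟩
  rw [lebesgueOn_apply, Set.image_univ, Subtype.range_coe]
  exact isCompact_Icc.measure_lt_top

theorem lebesgueOn_Ioi_pos {a b : ℝ} {c : Set.Icc a b} (hc : (c : ℝ) < b) :
    0 < lebesgueOn a b (Set.Ioi c) := by
  rw [lebesgueOn_apply]
  refine lt_of_lt_of_le ?_ (measure_mono (show Set.Ioc (c : ℝ) b ⊆ _ from ?_))
  · simpa using hc
  · intro x hx
    exact ⟨⟨x, c.2.1.trans hx.1.le, hx.2⟩, hx.1, rfl⟩

namespace Market

variable (E : Market)

instance isProbabilityMeasure_μ : IsProbabilityMeasure E.μ := E.isProb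

theorem ωLo_lt_ωHi : E.ωLo < E.ωHi := by
  obtain ⟨ω, h1, h2, -⟩ := E.singleCrossing
  exact h1.trans h2

instance preconnectedSpace_state : PreconnectedSpace E.State :=
  Subtype.preconnectedSpace isPreconnected_Icc

instance preconnectedSpace_sellerType : PreconnectedSpace E.SellerType :=
  Subtype.preconnectedSpace isPreconnected_Icc

/-- The lowest state. -/
noncomputable def lowState : E.State := ⟨E.ωLo, le_rfl, E.ωLo_lt_ωHi.le⟩

instance nonempty_state : Nonempty E.State := ⟨E.lowState⟩

/-- The lowest type of the seller. -/
noncomputable def lowType : E.SellerType := ⟨E.yLo, le_rfl, E.yLo_lt_yHi.le⟩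

/-- The highest type of the seller. -/
noncomputable def highType : E.SellerType := ⟨E.yHi, E.yLo_lt_yHi.le, le_rfl⟩

theorem lowState_le (ω : E.State) : E.lowState ≤ ω := ω.2.1

theorem lowType_le (y : E.SellerType) : E.lowType ≤ y := y.2.1

theorem le_highType (y : E.SellerType) : y ≤ E.highType := y.2.2

/-- The probability of a signal given the state, when it does not depend on the type. -/
noncomputable def sig (x : E.X) (ω : E.State) : ℝ := E.f x E.lowType ω

/-- The arrival rate of `x̄`-buyers given the state. -/
noncomputable def hazard (ω : E.State) : ℝ := E.rate * E.sig E.xbar ω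

variable {E}

theorem f_eq_sig (hReg : E.Regular) (x : E.X) (y : E.SellerType) (ω : E.State) :
    E.f x y ω = E.sig x ω := hReg.condIndep _ _ _ _

@[fun_prop]
theorem continuous_sig (x : E.X) : Continuous (E.sig x) :=
  (E.f_continuous x).comp (by fun_prop : Continuous fun ω : E.State => (E.lowType, ω))

theorem sig_pos (x : E.X) (ω : E.State) : 0 < E.sig x ω := E.f_pos _ _ _

theorem sum_sig (ω : E.State) : ∑ x, E.sig x ω = 1 := E.f_sum _ _

@[fun_prop]
theorem continuous_hazard : Continuous E.hazard := by
  unfold hazard; fun_prop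

theorem hazard_pos (ω : E.State) : 0 < E.hazard ω := mul_pos E.rate_pos (sig_pos _ _)

theorem lt_xbar {x : E.X} (hx : x ≠ E.xbar) : x < E.xbar :=
  lt_of_le_of_ne (E.X.le_max' _ x.2) hx

theorem exists_ne_xbar : ∃ x : E.X, x ≠ E.xbar := by
  obtain ⟨x, hx, hne⟩ := Finset.exists_mem_ne (lt_of_lt_of_le one_lt_two E.two_le_card) E.xbar
  exact ⟨⟨x, hx⟩, fun h => hne (by rw [← h])⟩

theorem sig_ratio {x : E.X} (hx : x ≠ E.xbar) {ω ω' : E.State} (h : ω' < ω) :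
    E.sig E.xbar ω' * E.sig x ω < E.sig E.xbar ω * E.sig x ω' :=
  E.strict_signal_state _ _ _ _ _ (lt_xbar hx) h

theorem sig_ratio_le (x : E.X) {ω ω' : E.State} (h : ω' ≤ ω) :
    E.sig x ω * E.sig E.xbar ω' ≤ E.sig x ω' * E.sig E.xbar ω := by
  by_cases hx : x = E.xbar
  · subst hx; exact (mul_comm _ _).le
  · rcases h.eq_or_lt with rfl | h
    · exact le_rfl
    · linarith [sig_ratio hx h]

/-- The likelihood ratio of each signal to the highest one falls with the state, strictly for every
other signal. Summing the cross-multiplied inequalities over signals leaves only the probabilities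
of the highest signal. -/
theorem hazard_strictMono : StrictMono E.hazard := by
  intro ω' ω h
  refine mul_lt_mul_of_pos_left ?_ E.rate_pos
  obtain ⟨x₀, hx₀⟩ := E.exists_ne_xbar
  calc E.sig E.xbar ω' = ∑ x, E.sig E.xbar ω' * E.sig x ω := by
        rw [← Finset.mul_sum, sum_sig, mul_one]
    _ < ∑ x, E.sig E.xbar ω * E.sig x ω' := by
        refine Finset.sum_lt_sum (fun x _ => ?_) ⟨x₀, Finset.mem_univ _, sig_ratio hx₀ h⟩
        linarith [sig_ratio_le x h.le]
    _ = E.sig E.xbar ω := by rw [← Finset.mul_sum, sum_sig, mul_one]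

@[fun_prop]
theorem continuous_g {X : Type*} [TopologicalSpace X] {a : X → E.SellerType} {b : X → E.State}
    (ha : Continuous a) (hb : Continuous b) : Continuous fun x => E.g (a x) (b x) :=
  E.g_continuous.comp (ha.prodMk hb)

attribute [fun_prop] Market.vB_continuous Market.vS_continuous

/-- Positivity extends from interior types to the end points: without zeros on a connected type
space the density has a constant sign, which is read off at the midpoint. -/
theorem g_pos_everywhere (hReg : E.Regular) (y : E.SellerType) (ω : E.State) : 0 < E.g y ω := by
  rcases forall_pos_or_forall_neg_or_exists_zero
    (φ := fun y => E.g y ω) (by fun_prop) with h | h | ⟨y', h⟩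
  · exact h y
  · have h1 := E.yLo_lt_yHi
    have := E.g_pos ⟨(E.yLo + E.yHi) / 2, by linarith, by linarith⟩ ω
      (by simp only; linarith) (by simp only; linarith)
    exact absurd (h _) (not_lt.mpr this.le)
  · exact absurd h (hReg.bounded _ _)

/-- Log-supermodularity is applied with equal signals; the signal probabilities do not depend on the
type and cancel. -/
theorem g_ratio_le (hReg : E.Regular) {y y' : E.SellerType} (hy : y' ≤ y) {ω ω' : E.State} (hω : ω' ≤ ω) :
    E.g y ω' * E.g y' ω ≤ E.g y ω * E.g y' ω' := by
  have h := E.logSupermodular E.xbar E.xbar y y' ω' ω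
  rw [max_eq_left hy, max_eq_right hω, min_eq_right hy, min_eq_left hω, max_self, min_self] at h
  simp only [f_eq_sig hReg] at h
  have hp := mul_pos (sig_pos E.xbar ω) (sig_pos E.xbar ω')
  nlinarith

theorem g_ratio_lt_of_interior (hReg : E.Regular) {y y' : E.SellerType} (hy' : E.yLo < (y' : ℝ))
    (hy1 : (y : ℝ) < E.yHi) (hy : y' < y) {ω ω' : E.State} (hω : ω' < ω) :
    E.g y ω' * E.g y' ω < E.g y ω * E.g y' ω' := by
  have h := E.strict_type_state E.xbar y y' ω ω' hy' hy1 hy hω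
  simp only [f_eq_sig hReg] at h
  have hp := mul_pos (sig_pos E.xbar ω) (sig_pos E.xbar ω')
  nlinarith

/-- Strictness is assumed for interior types only. Two interior types `a < b` are inserted between
`y'` and `y`; the comparison is weak on the outer steps and strict on the middle one. -/
theorem g_div_strictMono (hReg : E.Regular) {y y' : E.SellerType} (hy : y' < y) :
    StrictMono fun ω => E.g y ω / E.g y' ω := by
  intro ω' ω hω
  have hg := g_pos_everywhere hReg
  have hyr : (y' : ℝ) < y := hy
  have l1 : E.yLo ≤ y' := y'.2.1
  have l2 : (y : ℝ) ≤ E.yHi := y.2.2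
  let a : E.SellerType := ⟨(2 * y' + y) / 3, by linarith, by linarith⟩
  let b : E.SellerType := ⟨(y' + 2 * y) / 3, by linarith, by linarith⟩
  have hya : y' ≤ a := by change (y' : ℝ) ≤ (2 * y' + y) / 3; linarith
  have hab : a < b := by change (2 * (y' : ℝ) + y) / 3 < (y' + 2 * y) / 3; linarith
  have hby : b ≤ y := by change ((y' : ℝ) + 2 * y) / 3 ≤ y; linarith
  have ha : E.yLo < (a : ℝ) := by change E.yLo < (2 * (y' : ℝ) + y) / 3; linarith
  have hb : (b : ℝ) < E.yHi := by change ((y' : ℝ) + 2 * y) / 3 < E.yHi; linarith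
  have h1 : E.g y' ω / E.g y' ω' ≤ E.g a ω / E.g a ω' := by
    rw [div_le_div_iff₀ (hg _ _) (hg _ _)]
    linarith [g_ratio_le hReg hya hω.le]
  have h2 : E.g a ω / E.g a ω' < E.g b ω / E.g b ω' := by
    rw [div_lt_div_iff₀ (hg _ _) (hg _ _)]
    linarith [g_ratio_lt_of_interior hReg ha hb hab hω]
  have h3 : E.g b ω / E.g b ω' ≤ E.g y ω / E.g y ω' := by
    rw [div_le_div_iff₀ (hg _ _) (hg _ _)]
    linarith [g_ratio_le hReg hby hω.le]
  have h4 := (h1.trans_lt h2).trans_le h3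
  rw [div_lt_div_iff₀ (hg _ _) (hg _ _)] at h4 ⊢
  linarith

/-- The highest type would trade at the posterior value of an `x̄`-buyer at time `0`. -/
theorem highType_surplus_pos (hTrade : E.TradeIsPossible) (hReg : E.Regular) :
    0 < ∫ ω, (E.vB ω - E.vS ω) * (E.hazard ω * E.g E.highType ω) ∂E.μ := by
  have hc : Continuous fun y : E.SellerType =>
      ∫ ω, (E.vB ω - E.vS ω) * E.g y ω * E.f E.xbar y ω ∂E.μ := by
    simp only [f_eq_sig hReg]
    refine continuous_integral_of_compactSpace ?_
    unfold Function.uncurry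
    fun_prop
  -- By continuity in the type, the limsup is the value at the highest type itself.
  have hle : comap (fun y : E.SellerType => (y : ℝ)) (𝓝[<] E.yHi) ≤ 𝓝 E.highType := by
    rw [nhds_subtype]
    exact comap_mono nhdsWithin_le_nhds
  have hlim : Tendsto (fun y : E.SellerType =>
      ((∫ ω, (E.vB ω - E.vS ω) * E.g y ω * E.f E.xbar y ω ∂E.μ : ℝ) : EReal))
      (comap (fun y : E.SellerType => (y : ℝ)) (𝓝[<] E.yHi))
      (𝓝 ((∫ ω, (E.vB ω - E.vS ω) * E.g E.highType ω * E.f E.xbar E.highType ω ∂E.μ : ℝ) : EReal)) :=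
    ((continuous_coe_real_ereal.comp hc).tendsto E.highType).mono_left hle
  have hne : (comap (fun y : E.SellerType => (y : ℝ)) (𝓝[<] E.yHi)).NeBot := by
    rw [comap_neBot_iff_frequently]
    refine Eventually.frequently ?_
    filter_upwards [Ioo_mem_nhdsLT E.yLo_lt_yHi] with y hy
    exact ⟨⟨y, hy.1.le, hy.2.le⟩, rfl⟩
  have hpos : (0 : EReal) < _ := hTrade
  rw [hlim.limsup_eq] at hpos
  have hpos' := EReal.coe_pos.mp hpos
  have : ∫ ω, (E.vB ω - E.vS ω) * (E.hazard ω * E.g E.highType ω) ∂E.μ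
      = E.rate * ∫ ω, (E.vB ω - E.vS ω) * E.g E.highType ω * E.f E.xbar E.highType ω ∂E.μ := by
    rw [← integral_const_mul]
    refine integral_congr_ae (Eventually.of_forall fun ω => ?_)
    simp only [f_eq_sig hReg, hazard]; ring
  rw [this]
  exact mul_pos E.rate_pos hpos'

theorem measure_Iio_ne_zero (hSupp : E.LowestStateInSupport) (ω : E.State) (h : E.lowState < ω) :
    E.μ (Set.Iio ω) ≠ 0 :=
  ((E.μ.mem_support_iff_forall _).mp (hSupp E.lowState rfl) _ (Iio_mem_nhds h)).ne'

/-- The prior is not degenerate. -/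
theorem measure_compl_singleton_ne_zero (hTrade : E.TradeIsPossible)
    (hSupp : E.LowestStateInSupport) (hReg : E.Regular) (ω : E.State) : E.μ {ω}ᶜ ≠ 0 := by
  intro h0
  -- All mass on one state would have to sit at the lowest state, which lies in the support. There
  -- the surplus is negative, against `highType_surplus_pos`.
  have hω : ω = E.lowState := by
    by_contra hne
    exact ((E.μ.mem_support_iff_forall _).mp (hSupp E.lowState rfl) {ω}ᶜ
      (isOpen_compl_singleton.mem_nhds (Ne.symm hne))).ne' h0
  subst hω
  have hpos := highType_surplus_pos hTrade hReg
  have hae : ∀ᵐ ω ∂E.μ, ω = E.lowState := h0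
  refine absurd hpos (not_lt.mpr (integral_nonpos_of_ae ?_))
  filter_upwards [hae] with ω hω
  obtain ⟨ω₀, h1, -, -, h2, -⟩ := E.singleCrossing
  have := h2 E.lowState h1
  rw [hω]
  exact mul_nonpos_of_nonpos_of_nonneg this.le
    (mul_pos (hazard_pos _) (g_pos_everywhere hReg _ _)).le

theorem vS_lowState (hReg : E.Regular) : ⨆ ω, E.vS ω = E.vS E.lowState :=
  le_antisymm (ciSup_le fun ω => hReg.vS_strictAnti.antitone (E.lowState_le ω))
    (le_ciSup (isCompact_range E.vS_continuous).bddAbove _)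

end Market

theorem Continuous.integral_pos_of_forall_pos {Ω : Type*} [TopologicalSpace Ω] [CompactSpace Ω]
    [MeasurableSpace Ω] [OpensMeasurableSpace Ω] {μ : Measure Ω} [IsFiniteMeasure μ] [NeZero μ]
    {f : Ω → ℝ} (hf : Continuous f) (hpos : ∀ ω, 0 < f ω) : 0 < ∫ ω, f ω ∂μ := by
  rw [integral_pos_iff_support_of_nonneg (fun ω => (hpos ω).le) hf.integrable_of_compactSpace,
    Function.support_eq_univ fun ω => (hpos ω).ne']
  exact Measure.measure_univ_pos.mpr (NeZero.ne μ)

/-! ### The gain from trade and the exit time -/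

namespace Market

/-- The standing assumptions on the market. -/
structure Standing (E : Market) : Prop where
  trade : E.TradeIsPossible
  supp : E.LowestStateInSupport
  reg : E.Regular

/-- The seller's flow gain from trading at price `p` at time `r` with `x̄`-buyers only, weighted by
the (unnormalized) posterior. -/
noncomputable def gain (E : Market) (p r : ℝ) (y : E.SellerType) : ℝ :=
  ∫ ω, (p - E.vS ω) * E.g y ω * (E.hazard ω * Real.exp (-(E.hazard ω * r))) ∂E.μ

/-- The first time at which the gain from trading at price `p` is nonpositive. -/
noncomputable def exitTime (E : Market) (p : ℝ) (y : E.SellerType) : ℝ≥0 :=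
  sInf {r : ℝ≥0 | E.gain p r y ≤ 0}

variable {E : Market}

theorem continuous_gain : Continuous fun q : ℝ × ℝ × E.SellerType => E.gain q.1 q.2.1 q.2.2 := by
  refine continuous_integral_of_compactSpace ?_
  unfold Function.uncurry
  fun_prop

theorem continuous_gain_comp {X : Type*} [TopologicalSpace X] {p r : X → ℝ} {y : X → E.SellerType}
    (hp : Continuous p) (hr : Continuous r) (hy : Continuous y) :
    Continuous fun x => E.gain (p x) (r x) (y x) :=
  continuous_gain.comp (hp.prodMk (hr.prodMk hy))

namespace Standing

variable (h : E.Standing)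
include h

theorem g_pos (y : E.SellerType) (ω : E.State) : 0 < E.g y ω := g_pos_everywhere h.reg y ω

/-- Going back from `r'` to `r` multiplies the weights by `exp (hazard * (r' - r))`, which is
strictly increasing in the state, as is the margin. So `gain` crosses zero at most once in time,
from above. -/
theorem gain_pos_of_lt_time {p r r' : ℝ} {y : E.SellerType} (hr : r < r')
    (h0 : 0 ≤ E.gain p r' y) : 0 < E.gain p r y := by
  have key := integral_mul_pos_of_strictMono (μ := E.μ) (φ := fun ω => p - E.vS ω)
    (w := fun ω => E.g y ω * (E.hazard ω * Real.exp (-(E.hazard ω * r'))))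
    (m := fun ω => Real.exp (E.hazard ω * (r' - r))) (by fun_prop)
    (fun a b hab => sub_lt_sub_left (h.reg.vS_strictAnti hab) p)
    (fun a b hab => Real.exp_lt_exp.mpr
      (mul_lt_mul_of_pos_right (hazard_strictMono hab) (sub_pos.mpr hr)))
    (fun _ => Real.exp_pos _)
    (fun ω => mul_pos (h.g_pos _ _) (mul_pos (hazard_pos _) (Real.exp_pos _)))
    (Continuous.integrable_of_compactSpace (by fun_prop))
    (Continuous.integrable_of_compactSpace (by fun_prop))
    (measure_compl_singleton_ne_zero h.trade h.supp h.reg)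
    (by simpa only [gain, mul_assoc] using h0)
  convert key using 1
  refine integral_congr_ae (Eventually.of_forall fun ω => ?_)
  have : Real.exp (-(E.hazard ω * r)) =
      Real.exp (E.hazard ω * (r' - r)) * Real.exp (-(E.hazard ω * r')) := by
    rw [← Real.exp_add]; ring_nf
  simp only [this]
  ring

/-- A change of type multiplies the weights by the density ratio, which is strictly increasing in
the state. -/
theorem gain_pos_of_lt_type {p r : ℝ} {y y' : E.SellerType} (hy : y < y')
    (h0 : 0 ≤ E.gain p r y) : 0 < E.gain p r y' := by
  have hne : ∀ ω, E.g y ω ≠ 0 := fun ω => (h.g_pos y ω).ne'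
  have key := integral_mul_pos_of_strictMono (μ := E.μ) (φ := fun ω => p - E.vS ω)
    (w := fun ω => E.g y ω * (E.hazard ω * Real.exp (-(E.hazard ω * r))))
    (m := fun ω => E.g y' ω / E.g y ω) (by fun_prop)
    (fun a b hab => sub_lt_sub_left (h.reg.vS_strictAnti hab) p)
    (g_div_strictMono h.reg hy)
    (fun ω => div_pos (h.g_pos _ _) (h.g_pos _ _))
    (fun ω => mul_pos (h.g_pos _ _) (mul_pos (hazard_pos _) (Real.exp_pos _)))
    (Continuous.integrable_of_compactSpace (by fun_prop))
    (Continuous.integrable_of_compactSpace (by fun_prop (disch := exact hne)))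
    (measure_compl_singleton_ne_zero h.trade h.supp h.reg)
    (by simpa only [gain, mul_assoc] using h0)
  convert key using 1
  refine integral_congr_ae (Eventually.of_forall fun ω => ?_)
  have := hne ω
  simp only
  field_simp

theorem gain_lt_of_lt_price {p p' r : ℝ} {y : E.SellerType} (hp : p < p') :
    E.gain p r y < E.gain p' r y := by
  rw [← sub_pos, gain, gain, ← integral_sub
    (Continuous.integrable_of_compactSpace (by fun_prop))
    (Continuous.integrable_of_compactSpace (by fun_prop))]
  refine Continuous.integral_pos_of_forall_pos (by fun_prop) fun ω => ?_
  have := mul_pos (mul_pos (sub_pos.mpr hp) (h.g_pos y ω))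
    (mul_pos (hazard_pos ω) (Real.exp_pos (-(E.hazard ω * r))))
  linarith

/-- The margin is negative at the lowest state, near which the prior has mass, and late times select
exactly these states. -/
theorem exists_gain_nonpos {p : ℝ} (hp : p < E.vS E.lowState) (y : E.SellerType) :
    ∃ r : ℝ≥0, E.gain p r y ≤ 0 := by
  obtain ⟨r, hr, hle⟩ := exists_integral_mul_exp_nonpos (μ := E.μ) (φ := fun ω => p - E.vS ω)
    (w := fun ω => E.g y ω * E.hazard ω) (k := E.hazard) (by fun_prop)
    (fun a b hab => sub_lt_sub_left (h.reg.vS_strictAnti hab) p) (by fun_prop)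
    hazard_strictMono (by fun_prop) (fun ω => mul_pos (h.g_pos _ _) (hazard_pos _))
    (sub_neg.mpr hp) (measure_Iio_ne_zero h.supp)
  refine ⟨⟨r, hr⟩, ?_⟩
  change E.gain p r y ≤ 0
  simpa only [gain, mul_assoc] using hle

variable {p : ℝ} (hp : p < E.vS E.lowState)
include hp

theorem isLeast_exitTime (y : E.SellerType) :
    IsLeast {r : ℝ≥0 | E.gain p r y ≤ 0} (E.exitTime p y) := by
  have hcl : IsClosed {r : ℝ≥0 | E.gain p r y ≤ 0} :=
    isClosed_le (continuous_gain_comp (by fun_prop) (by fun_prop) (by fun_prop)) continuous_const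
  exact ⟨hcl.csInf_mem (h.exists_gain_nonpos hp y) (OrderBot.bddBelow _),
    fun r hr => csInf_le (OrderBot.bddBelow _) hr⟩

/-- Single crossing in time turns comparisons with the exit time into signs of the continuous
function `gain`. This and `exitTime_lt_iff` carry the continuity and monotonicity of exit times. -/
theorem lt_exitTime_iff {r : ℝ≥0} {y : E.SellerType} :
    r < E.exitTime p y ↔ 0 < E.gain p r y := by
  have hl := h.isLeast_exitTime hp y
  constructor
  · intro hr
    by_contra! hle
    exact absurd (hl.2 hle) (not_le.mpr hr)
  · intro hr
    by_contra! hle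
    rcases hle.eq_or_lt with heq | hlt
    · exact absurd hl.1 (by simpa [heq] using hr)
    · exact absurd hl.1 (not_le.mpr (h.gain_pos_of_lt_time (NNReal.coe_lt_coe.mpr hlt) hr.le))

/-- The condition `0 < r` is needed because a negative gain at time zero gives exit time zero. For
positive `r`, a negative gain persists slightly to the left of `r`. -/
theorem exitTime_lt_iff {r : ℝ≥0} {y : E.SellerType} :
    E.exitTime p y < r ↔ 0 < r ∧ E.gain p r y < 0 := by
  have hl := h.isLeast_exitTime hp y
  constructor
  · intro hr
    refine ⟨pos_iff_ne_zero.mpr fun h0 => not_lt_bot (h0 ▸ hr), ?_⟩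
    by_contra! hge
    exact absurd hl.1 (not_le.mpr (h.gain_pos_of_lt_time (NNReal.coe_lt_coe.mpr hr) hge))
  · rintro ⟨h0, hr⟩
    have hopen : IsOpen {r : ℝ≥0 | E.gain p r y < 0} :=
      isOpen_lt (continuous_gain_comp (by fun_prop) (by fun_prop) (by fun_prop)) continuous_const
    have : (𝓝[<] r).NeBot := nhdsLT_neBot_of_exists_lt ⟨0, h0⟩
    obtain ⟨r', h1, h2⟩ :=
      ((hopen.eventually_mem hr).filter_mono nhdsWithin_le_nhds |>.and
        (self_mem_nhdsWithin : ∀ᶠ r' in 𝓝[<] r, r' ∈ Set.Iio r)).exists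
    exact (hl.2 (le_of_lt (show E.gain p r' y < 0 from h1))).trans_lt h2

theorem exitTime_pos_of_gain_pos {y : E.SellerType} (hg : 0 < E.gain p 0 y) :
    0 < E.exitTime p y := (h.lt_exitTime_iff hp).mpr (by simpa using hg)

theorem exitTime_eq_zero_of_gain_nonpos {y : E.SellerType} (hg : E.gain p 0 y ≤ 0) :
    E.exitTime p y = 0 :=
  le_antisymm ((h.isLeast_exitTime hp y).2 (by simpa using hg)) bot_le

theorem monotone_exitTime : Monotone (E.exitTime p) := by
  intro y y' hy
  rcases hy.eq_or_lt with rfl | hy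
  · exact le_rfl
  · by_contra! hlt
    exact absurd ((h.isLeast_exitTime hp y').1)
      (not_le.mpr (h.gain_pos_of_lt_type hy ((h.lt_exitTime_iff hp).mp hlt).le))

theorem gain_exitTime_nonneg {y : E.SellerType} (hy : E.exitTime p y ≠ 0) :
    0 ≤ E.gain p (E.exitTime p y) y := by
  by_contra! hneg
  exact lt_irrefl _ ((h.exitTime_lt_iff hp).mpr ⟨pos_iff_ne_zero.mpr hy, hneg⟩)

/-- When the lower type leaves after a positive time, its gain is still nonnegative, so that of the
higher type is strictly positive. -/
theorem exitTime_lt_of_lt {y y' : E.SellerType} (hy : y < y') (hne : E.exitTime p y ≠ 0) :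
    E.exitTime p y < E.exitTime p y' :=
  (h.lt_exitTime_iff hp).mpr (h.gain_pos_of_lt_type hy (h.gain_exitTime_nonneg hp hne))

/-- Lower and upper bounds on the exit time are strict signs of `gain`, hence open conditions
jointly in price and type. Dependence on the price is needed for the fixed-point argument. -/
theorem continuousAt_exitTime (y : E.SellerType) :
    ContinuousAt (fun q : ℝ × E.SellerType => E.exitTime q.1 q.2) (p, y) := by
  have hev : ∀ᶠ q : ℝ × E.SellerType in 𝓝 (p, y), q.1 < E.vS E.lowState :=
    (isOpen_lt continuous_fst continuous_const).mem_nhds hp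
  have hc : ∀ r : ℝ≥0, Continuous fun q : ℝ × E.SellerType => E.gain q.1 r q.2 := fun r =>
    continuous_gain_comp (by fun_prop) (by fun_prop) (by fun_prop)
  refine tendsto_order.mpr ⟨fun r hr => ?_, fun r hr => ?_⟩
  · have h1 := (h.lt_exitTime_iff hp).mp hr
    filter_upwards [hev, (isOpen_lt continuous_const (hc r)).mem_nhds h1] with q hq hq1
    exact (h.lt_exitTime_iff hq).mpr hq1
  · have h1 := (h.exitTime_lt_iff hp).mp hr
    filter_upwards [hev, (isOpen_lt (hc r) continuous_const).mem_nhds h1.2] with q hq hq1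
    exact (h.exitTime_lt_iff hq).mpr ⟨h1.1, hq1⟩

theorem continuous_exitTime : Continuous (E.exitTime p) :=
  continuous_iff_continuousAt.mpr fun y =>
    (h.continuousAt_exitTime hp y).comp (f := fun y => (p, y))
      (by fun_prop : Continuous fun y : E.SellerType => (p, y)).continuousAt

end Standing

end Market

/-! ### The equilibrium price -/

namespace Market

/-- The expectation of `φ` on the event that an `x̄`-buyer arrives before the exit time. -/
noncomputable def tradeIntegral (E : Market) (φ : E.State → ℝ) (s : E.SellerType → ℝ≥0) : ℝ :=
  ∫ y, ∫ ω, φ ω * E.g y ω * (1 - Real.exp (-(E.hazard ω * s y))) ∂E.μ ∂E.typeVolume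

variable {E : Market}

theorem integral_type_state_swap {F : E.SellerType → E.State → ℝ}
    (hF : Continuous (Function.uncurry F)) :
    ∫ y, ∫ ω, F y ω ∂E.μ ∂E.typeVolume = ∫ ω, ∫ y, F y ω ∂E.typeVolume ∂E.μ :=
  integral_integral_swap hF.integrable_of_compactSpace

namespace Standing

variable (h : E.Standing)
include h

/-- The margin then vanishes at the lowest state only, and the prior is not concentrated there. -/
theorem gain_pos_of_price_eq (r : ℝ) (y : E.SellerType) : 0 < E.gain (E.vS E.lowState) r y := by
  have hw : ∀ ω, 0 < E.g y ω * (E.hazard ω * Real.exp (-(E.hazard ω * r))) := fun ω =>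
    mul_pos (h.g_pos _ _) (mul_pos (hazard_pos _) (Real.exp_pos _))
  rw [gain, integral_pos_iff_support_of_nonneg]
  · refine (pos_iff_ne_zero.mpr (measure_compl_singleton_ne_zero h.trade h.supp h.reg
      E.lowState)).trans_le (measure_mono fun ω hω => ?_)
    have hlt : E.lowState < ω := lt_of_le_of_ne (E.lowState_le ω) (Ne.symm hω)
    rw [Function.mem_support, mul_assoc]
    exact (mul_pos (sub_pos.mpr (h.reg.vS_strictAnti hlt)) (hw ω)).ne'
  · intro ω
    simp only [Pi.zero_apply]
    rw [mul_assoc]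
    exact mul_nonneg (sub_nonneg.mpr (h.reg.vS_strictAnti.antitone (E.lowState_le ω))) (hw ω).le
  · exact Continuous.integrable_of_compactSpace (by fun_prop)

/-- The price at which the highest type is just indifferent at time `0`. -/
theorem exists_indifference_price :
    ∃ p₀ < E.vS E.lowState, E.gain p₀ 0 E.highType = 0 := by
  have hpos := h.gain_pos_of_price_eq 0 E.highType
  have hW : 0 < ∫ ω, E.g E.highType ω * E.hazard ω ∂E.μ :=
    Continuous.integral_pos_of_forall_pos (by fun_prop) fun ω =>
      mul_pos (h.g_pos _ _) (hazard_pos _)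
  -- At time zero the gain is affine in the price with positive slope, so its zero is a weighted
  -- mean of `vS`.
  have hlin : ∀ p, E.gain p 0 E.highType = p * (∫ ω, E.g E.highType ω * E.hazard ω ∂E.μ) -
      ∫ ω, E.vS ω * (E.g E.highType ω * E.hazard ω) ∂E.μ := by
    intro p
    rw [← integral_const_mul, ← integral_sub (Continuous.integrable_of_compactSpace (by fun_prop))
      (Continuous.integrable_of_compactSpace (by fun_prop)), gain]
    refine integral_congr_ae (Eventually.of_forall fun ω => ?_)
    simp
    ring
  refine ⟨(∫ ω, E.vS ω * (E.g E.highType ω * E.hazard ω) ∂E.μ) /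
    ∫ ω, E.g E.highType ω * E.hazard ω ∂E.μ, ?_, ?_⟩
  · rw [hlin] at hpos
    rw [div_lt_iff₀ hW]
    linarith
  · rw [hlin, div_mul_cancel₀ _ hW.ne', sub_self]

/-- At prices just above the indifference price of the highest type, the buyers' value conditional
on trade exceeds the price. -/
theorem exists_price_le_value {p₀ : ℝ} (hp₀ : p₀ < E.vS E.lowState)
    (h0 : E.gain p₀ 0 E.highType = 0) :
    ∃ p ∈ Set.Ioo p₀ (E.vS E.lowState),
      0 ≤ E.tradeIntegral (fun ω => E.vB ω - p) (E.exitTime p) := by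
  -- The flow of buyers' profit at a given price, time and type. At indifference of the seller it
  -- equals the whole surplus, hence is positive, and it stays positive nearby.
  let J : ℝ × ℝ × E.SellerType → ℝ := fun q =>
    ∫ ω, (E.vB ω - q.1) * E.g q.2.2 ω * (E.hazard ω * Real.exp (-(E.hazard ω * q.2.1))) ∂E.μ
  have hJc : Continuous J := by
    refine continuous_integral_of_compactSpace ?_
    unfold Function.uncurry
    fun_prop
  have hJ0 : 0 < J (p₀, 0, E.highType) := by
    have h1 := highType_surplus_pos h.trade h.reg
    have : J (p₀, 0, E.highType) + E.gain p₀ 0 E.highType =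
        ∫ ω, (E.vB ω - E.vS ω) * (E.hazard ω * E.g E.highType ω) ∂E.μ := by
      simp only [J, gain]
      rw [← integral_add (Continuous.integrable_of_compactSpace (by fun_prop))
        (Continuous.integrable_of_compactSpace (by fun_prop))]
      refine integral_congr_ae (Eventually.of_forall fun ω => ?_)
      simp
      ring
    linarith
  have hev : ∀ᶠ q in 𝓝 (p₀, (0 : ℝ), E.highType), 0 < J q :=
    hJc.continuousAt.eventually (lt_mem_nhds hJ0)
  rw [nhds_prod_eq, nhds_prod_eq] at hev
  obtain ⟨U, hU, W, hW, hUW⟩ := eventually_prod_iff.mp hev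
  obtain ⟨R, hR, V, hV, hRV⟩ := eventually_prod_iff.mp hW
  obtain ⟨δ, hδ, hRδ⟩ := Metric.eventually_nhds_iff.mp hR
  have hlow : E.lowType < E.highType := E.yLo_lt_yHi
  -- For prices near `p₀`, types up to `y₁` have exit time zero and all others exit before `δ`. All
  -- trade then falls in the neighbourhood where `J` is positive.
  obtain ⟨y₁, hy₁, hVy⟩ := exists_Ioc_subset_of_mem_nhds hV ⟨_, hlow⟩
  have hg1 : E.gain p₀ 0 y₁ < 0 := by
    by_contra! hge
    exact absurd h0 (h.gain_pos_of_lt_type hy₁ hge).ne'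
  have hδ' : (0 : ℝ≥0) < δ.toNNReal := Real.toNNReal_pos.mpr hδ
  have e1 : ∀ᶠ p in 𝓝 p₀, E.exitTime p E.highType < δ.toNNReal := by
    have hc := (h.continuousAt_exitTime hp₀ E.highType).comp (f := fun p : ℝ => (p, E.highType))
      (by fun_prop : Continuous fun p : ℝ => (p, E.highType)).continuousAt
    refine hc.eventually (gt_mem_nhds ?_)
    simpa [h.exitTime_eq_zero_of_gain_nonpos hp₀ h0.le] using hδ
  have e2 : ∀ᶠ p in 𝓝 p₀, E.gain p 0 y₁ < 0 :=
    (continuous_gain_comp continuous_id continuous_const continuous_const).continuousAt.eventually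
      (gt_mem_nhds hg1)
  have e3 : ∀ᶠ p in 𝓝 p₀, p < E.vS E.lowState := gt_mem_nhds hp₀
  obtain ⟨p, ⟨hpU, hp1, hp2, hp3⟩, hp4⟩ := ((hU.and (e1.and (e2.and e3))).filter_mono
    nhdsWithin_le_nhds |>.and (self_mem_nhdsWithin : ∀ᶠ p in 𝓝[>] p₀, p ∈ Set.Ioi p₀)).exists
  refine ⟨p, ⟨hp4, hp3⟩, integral_nonneg fun y => ?_⟩
  have hint := intervalIntegral_integral_mul_exp (μ := E.μ)
    (ψ := fun ω => (E.vB ω - p) * E.g y ω) (k := E.hazard) (by fun_prop) (by fun_prop) 0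
    (E.exitTime p y)
  simp only [mul_zero, neg_zero, Real.exp_zero] at hint
  simp only [Pi.zero_apply]
  rw [← hint]
  rcases le_or_gt y y₁ with hy | hy
  · have : E.exitTime p y = 0 := le_antisymm
      ((h.monotone_exitTime hp3 hy).trans (h.exitTime_eq_zero_of_gain_nonpos hp3 hp2.le).le) bot_le
    simp [this]
  · refine intervalIntegral.integral_nonneg (NNReal.coe_nonneg _) fun r hr => ?_
    have hr1 : r < δ := by
      have := (h.monotone_exitTime hp3 (E.le_highType y)).trans_lt hp1
      exact hr.2.trans_lt (Real.lt_toNNReal_iff_coe_lt.mp this)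
    have := hUW hpU (hRV (hRδ (y := r) (by simpa [abs_of_nonneg hr.1] using hr1))
      (hVy ⟨hy, E.le_highType y⟩))
    exact this.le

/-- A bound that does not depend on the type passes through the type integral because the density
has total mass one. -/
theorem integral_mul_density_le_of_le {ψ : E.State → ℝ} (hψ : Continuous ψ)
    {F : E.SellerType → E.State → ℝ} (hF : Continuous (Function.uncurry F))
    (hle : ∀ y ω, F y ω ≤ ψ ω) :
    ∫ y, ∫ ω, F y ω * E.g y ω ∂E.μ ∂E.typeVolume ≤ ∫ ω, ψ ω ∂E.μ := by
  have hFc : Continuous (Function.uncurry fun y ω => F y ω * E.g y ω) := by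
    unfold Function.uncurry at hF ⊢; fun_prop
  have hψc : Continuous (Function.uncurry fun y ω => ψ ω * E.g y ω) := by
    unfold Function.uncurry; fun_prop
  calc ∫ y, ∫ ω, F y ω * E.g y ω ∂E.μ ∂E.typeVolume
      ≤ ∫ y, ∫ ω, ψ ω * E.g y ω ∂E.μ ∂E.typeVolume := by
        refine integral_mono
          (continuous_integral_of_compactSpace hFc).integrable_of_compactSpace
          (continuous_integral_of_compactSpace hψc).integrable_of_compactSpace fun y => ?_
        refine integral_mono
          (Continuous.integrable_of_compactSpace (hFc.comp (by fun_prop : Continuous fun ω => (y, ω))))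
          (Continuous.integrable_of_compactSpace (hψc.comp (by fun_prop : Continuous fun ω => (y, ω))))
          fun ω => ?_
        exact mul_le_mul_of_nonneg_right (hle y ω) (h.g_pos y ω).le
    _ = ∫ ω, ψ ω ∂E.μ := by
        rw [integral_type_state_swap hψc]
        refine integral_congr_ae (Eventually.of_forall fun ω => ?_)
        simp only
        rw [integral_const_mul, E.g_integral, mul_one]

/-- At prices close to the maximal reservation value, trade is nearly certain and the price exceeds
the buyers' value. -/
theorem exists_value_le_price {p₀ : ℝ} (hp₀ : p₀ < E.vS E.lowState) :
    ∃ p ∈ Set.Ioo p₀ (E.vS E.lowState),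
      E.tradeIntegral (fun ω => E.vB ω - p) (E.exitTime p) ≤ 0 := by
  set P := E.vS E.lowState with hP
  set m := ∫ ω, E.vB ω ∂E.μ with hm
  have hmP : m < P := by rw [hP, ← vS_lowState h.reg]; exact h.reg.mean_lt_max
  obtain ⟨B, hB⟩ := isCompact_univ.exists_bound_of_continuousOn E.vB_continuous.continuousOn
  have hB' : ∀ ω, |E.vB ω| ≤ B := fun ω => hB ω (Set.mem_univ _)
  -- A bound on `|vB - p|` uniform over prices between `p₀` and `P`.
  set C := B + (|p₀| + |P|)
  set ε := (P - m) / 2 with hε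
  have hε0 : 0 < ε := by rw [hε]; linarith
  have hlim : Tendsto (fun R : ℝ => C * Real.exp (-(E.hazard E.lowState * R))) atTop (𝓝 (C * 0)) :=
    (Real.tendsto_exp_neg_atTop_nhds_zero.comp
      (tendsto_id.const_mul_atTop (hazard_pos E.lowState))).const_mul C
  rw [mul_zero] at hlim
  -- By `R` the chance of no trade costs less than `ε` in the lowest state, where arrivals are
  -- slowest, and hence in every state.
  obtain ⟨R, hR, hR0⟩ := ((hlim.eventually (gt_mem_nhds hε0)).and (eventually_ge_atTop 0)).exists
  have e1 : ∀ᶠ p in 𝓝 P, 0 < E.gain p R E.lowType :=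
    (continuous_gain_comp continuous_id continuous_const continuous_const).continuousAt.eventually
      (lt_mem_nhds (h.gain_pos_of_price_eq R E.lowType))
  have e2 : ∀ᶠ p in 𝓝 P, p₀ < p := lt_mem_nhds hp₀
  have e3 : ∀ᶠ p in 𝓝 P, m + ε < p := lt_mem_nhds (by rw [hε]; linarith)
  obtain ⟨p, ⟨hp1, hp2, hp3⟩, hp4⟩ := ((e1.and (e2.and e3)).filter_mono
    nhdsWithin_le_nhds |>.and (self_mem_nhdsWithin : ∀ᶠ p in 𝓝[<] P, p ∈ Set.Iio P)).exists
  have hp4' : p < P := hp4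
  refine ⟨p, ⟨hp2, hp4⟩, ?_⟩
  -- The lowest type exits first, so its exit time bounds all others from below.
  have hs : ∀ y, R ≤ E.exitTime p y := fun y => by
    have h1 : (⟨R, hR0⟩ : ℝ≥0) < E.exitTime p E.lowType := (h.lt_exitTime_iff hp4).mpr hp1
    exact (NNReal.coe_lt_coe.mpr (h1.trans_le (h.monotone_exitTime hp4 (E.lowType_le y)))).le
  have hCp : ∀ ω, |E.vB ω - p| ≤ C := fun ω => by
    have h1 := hB' ω
    have h2 : |p| ≤ |p₀| + |P| := by
      rw [abs_le]
      constructor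
      · linarith [neg_abs_le p₀, abs_nonneg P]
      · linarith [le_abs_self P, abs_nonneg p₀]
    exact (abs_sub _ _).trans (add_le_add h1 h2)
  have hbound : ∀ y ω, (E.vB ω - p) * (1 - Real.exp (-(E.hazard ω * E.exitTime p y)))
      ≤ E.vB ω - p + ε := by
    intro y ω
    have hexp : Real.exp (-(E.hazard ω * E.exitTime p y)) ≤
        Real.exp (-(E.hazard E.lowState * R)) := by
      refine Real.exp_le_exp.mpr (neg_le_neg ?_)
      exact mul_le_mul (hazard_strictMono.monotone (E.lowState_le ω)) (hs y) hR0 (hazard_pos ω).le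
    have h1 : -(E.vB ω - p) * Real.exp (-(E.hazard ω * E.exitTime p y)) ≤
        C * Real.exp (-(E.hazard E.lowState * R)) :=
      mul_le_mul ((neg_le_abs _).trans (hCp ω)) hexp (Real.exp_pos _).le
        ((abs_nonneg _).trans (hCp ω))
    linarith
  have hsc := h.continuous_exitTime hp4'
  have key := h.integral_mul_density_le_of_le (ψ := fun ω => E.vB ω - p + ε) (by fun_prop)
    (F := fun y ω => (E.vB ω - p) * (1 - Real.exp (-(E.hazard ω * E.exitTime p y))))
    (by unfold Function.uncurry; fun_prop) hbound
  have hval : ∫ ω, (E.vB ω - p + ε) ∂E.μ = m - p + ε := by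
    rw [integral_add (Continuous.integrable_of_compactSpace (by fun_prop)) (integrable_const _),
      integral_sub (Continuous.integrable_of_compactSpace (by fun_prop)) (integrable_const _)]
    simp [hm]
  rw [hval] at key
  have heq : E.tradeIntegral (fun ω => E.vB ω - p) (E.exitTime p) =
      ∫ y, ∫ ω, (E.vB ω - p) * (1 - Real.exp (-(E.hazard ω * E.exitTime p y))) * E.g y ω
        ∂E.μ ∂E.typeVolume := by
    simp only [tradeIntegral, mul_right_comm]
  rw [heq]
  linarith

/-- There is a price that equals the buyers' value conditional on trade with `x̄`-buyers, when the
seller optimally stops at this price. -/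
theorem exists_equilibrium_price :
    ∃ p < E.vS E.lowState, 0 < E.gain p 0 E.highType ∧
      E.tradeIntegral (fun ω => E.vB ω - p) (E.exitTime p) = 0 := by
  obtain ⟨p₀, hp₀, h0⟩ := h.exists_indifference_price
  obtain ⟨a, ha, ha0⟩ := h.exists_value_le_price hp₀
  obtain ⟨b, hb, hb0⟩ := h.exists_price_le_value hp₀ h0
  -- The intermediate value theorem is applied on the open interval as a space: its upper end keeps
  -- exit times finite and continuous, and its excluded lower end makes the gain of the highest type
  -- at time zero strictly positive.
  have : LocallyCompactSpace (Set.Ioo p₀ (E.vS E.lowState)) := isOpen_Ioo.locallyCompactSpace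
  have : PreconnectedSpace (Set.Ioo p₀ (E.vS E.lowState)) :=
    Subtype.preconnectedSpace isPreconnected_Ioo
  have hs : Continuous fun q : Set.Ioo p₀ (E.vS E.lowState) × E.SellerType =>
      E.exitTime q.1 q.2 :=
    continuous_iff_continuousAt.mpr fun q => (h.continuousAt_exitTime q.1.2.2 q.2).comp
      (f := fun q : Set.Ioo p₀ (E.vS E.lowState) × E.SellerType => ((q.1 : ℝ), q.2))
      (by fun_prop : Continuous fun q : Set.Ioo p₀ (E.vS E.lowState) × E.SellerType =>
        ((q.1 : ℝ), q.2)).continuousAt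
  have hc : Continuous fun p : Set.Ioo p₀ (E.vS E.lowState) =>
      E.tradeIntegral (fun ω => E.vB ω - p) (E.exitTime p) := by
    refine continuous_integral_of_compactSpace ?_
    refine continuous_integral_of_compactSpace (X := Set.Ioo p₀ (E.vS E.lowState) × E.SellerType)
      (f := fun q ω => (E.vB ω - q.1) * E.g q.2 ω *
        (1 - Real.exp (-(E.hazard ω * E.exitTime q.1 q.2)))) ?_
    unfold Function.uncurry
    have hs' : Continuous fun q : (Set.Ioo p₀ (E.vS E.lowState) × E.SellerType) × E.State =>
      E.exitTime q.1.1 q.1.2 := hs.comp continuous_fst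
    fun_prop
  obtain ⟨p, hp⟩ := mem_range_of_exists_le_of_exists_ge hc ⟨⟨a, ha⟩, ha0⟩ ⟨⟨b, hb⟩, hb0⟩
  exact ⟨p, p.2.2, h0.symm.trans_lt (h.gain_lt_of_lt_price p.2.1), hp⟩

end Standing

end Market

/-! ### Posterior values conditional on trade -/

theorem intervalIntegral_const_mul_exp_neg {k : ℝ} (hk : 0 < k) (c s : ℝ) :
    ∫ t in (0 : ℝ)..s, c * Real.exp (-(k * t)) = c * ((1 - Real.exp (-(k * s))) / k) := by
  have hd : ∀ t ∈ Set.uIcc 0 s, HasDerivAt (fun t => -(c / k) * Real.exp (-(k * t)))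
      (c * Real.exp (-(k * t))) t := by
    intro t _
    have h := ((((hasDerivAt_id t).const_mul k).neg).exp.const_mul (-(c / k)))
    convert! h using 1
    simp only [Pi.neg_apply, id]
    field_simp
  rw [intervalIntegral.integral_eq_sub_of_hasDerivAt hd
    (Continuous.intervalIntegrable (by fun_prop) _ _)]
  simp
  field_simp
  ring

theorem setIntegral_Ici_mul_ite {F : ℝ → ℝ} {s : ℝ} (hs : 0 ≤ s) :
    ∫ t in Set.Ici (0 : ℝ), F t * (if t ≤ s then 1 else 0) = ∫ t in (0 : ℝ)..s, F t := by
  have : (fun t => F t * (if t ≤ s then 1 else 0)) = (Set.Iic s).indicator F := by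
    ext t
    simp [Set.indicator_apply]
  rw [this, setIntegral_indicator measurableSet_Iic, Set.Ici_inter_Iic,
    intervalIntegral.integral_of_le hs, integral_Icc_eq_integral_Ioc]

namespace Market

variable {E : Market}

/-- The (unnormalized) expected time, given the state, during which the good is offered. -/
noncomputable def offerTime (E : Market) (s : E.SellerType → ℝ≥0) (ω : E.State) : ℝ :=
  ∫ y, (1 - Real.exp (-(E.hazard ω * s y))) / E.hazard ω * E.g y ω ∂E.typeVolume

theorem one_sub_exp_nonneg (r : ℝ≥0) (ω : E.State) : 0 ≤ 1 - Real.exp (-(E.hazard ω * r)) := by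
  rw [sub_nonneg, Real.exp_le_one_iff]
  have := mul_nonneg (hazard_pos ω).le r.2
  exact neg_nonpos.mpr this

theorem one_sub_exp_pos {r : ℝ≥0} (hr : 0 < r) (ω : E.State) :
    0 < 1 - Real.exp (-(E.hazard ω * r)) := by
  rw [sub_pos, Real.exp_lt_one_iff]
  exact neg_neg_of_pos (mul_pos (hazard_pos ω) hr)

theorem continuous_offerTime {s : E.SellerType → ℝ≥0} (hs : Continuous s) :
    Continuous (E.offerTime s) := by
  refine continuous_integral_of_compactSpace ?_
  unfold Function.uncurry
  fun_prop (disch := exact fun _ => (hazard_pos _).ne')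

/-- With time and type integrated out, the signal enters the weights only through `sig x`, so values
of different signals can be compared by likelihood ratios. -/
theorem passiveValue_eq (hReg : E.Regular) (s : E.SellerType → ℝ≥0) (x : E.X) :
    E.passiveValue s x = (∫ ω, E.vB ω * (E.sig x ω * E.offerTime s ω) ∂E.μ) /
      ∫ ω, E.sig x ω * E.offerTime s ω ∂E.μ := by
  unfold passiveValue
  simp only [f_eq_sig hReg]
  congr 1
  · refine integral_congr_ae (Eventually.of_forall fun ω => ?_)
    simp only [offerTime]
    rw [← integral_const_mul, ← integral_const_mul]
    refine integral_congr_ae (Eventually.of_forall fun y => ?_)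
    simp only
    have hI := (setIntegral_Ici_mul_ite (F := fun t => E.vB ω * E.sig x ω *
      Real.exp (-(E.hazard ω * t))) (s y).coe_nonneg).trans
      (intervalIntegral_const_mul_exp_neg (hazard_pos ω) _ _)
    simp only [hazard] at hI ⊢
    rw [hI]
    ring
  · refine integral_congr_ae (Eventually.of_forall fun ω => ?_)
    simp only [offerTime]
    rw [← integral_const_mul]
    refine integral_congr_ae (Eventually.of_forall fun y => ?_)
    simp only
    have hI := (setIntegral_Ici_mul_ite (F := fun t => E.sig x ω *
      Real.exp (-(E.hazard ω * t))) (s y).coe_nonneg).trans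
      (intervalIntegral_const_mul_exp_neg (hazard_pos ω) _ _)
    simp only [hazard] at hI ⊢
    rw [hI]
    ring

theorem tradeIntegral_eq_offerTime {φ : E.State → ℝ} (hφ : Continuous φ)
    {s : E.SellerType → ℝ≥0} (hs : Continuous s) :
    E.tradeIntegral φ s = ∫ ω, φ ω * (E.hazard ω * E.offerTime s ω) ∂E.μ := by
  rw [tradeIntegral, integral_type_state_swap (by unfold Function.uncurry; fun_prop)]
  refine integral_congr_ae (Eventually.of_forall fun ω => ?_)
  simp only [offerTime]
  rw [← integral_const_mul, ← integral_const_mul]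
  refine integral_congr_ae (Eventually.of_forall fun y => ?_)
  have := (hazard_pos ω).ne'
  simp only
  field_simp

/-- Since `hazard` is proportional to `sig E.xbar`, zero expected profit conditional on trade is
zero profit of a highest-signal buyer under passive beliefs. -/
theorem integral_xbar_eq_zero {s : E.SellerType → ℝ≥0} (hs : Continuous s) {p : ℝ}
    (hp : E.tradeIntegral (fun ω => E.vB ω - p) s = 0) :
    ∫ ω, (E.vB ω - p) * (E.sig E.xbar ω * E.offerTime s ω) ∂E.μ = 0 := by
  rw [tradeIntegral_eq_offerTime (by fun_prop) hs] at hp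
  have : E.rate * ∫ ω, (E.vB ω - p) * (E.sig E.xbar ω * E.offerTime s ω) ∂E.μ = 0 := by
    rw [← integral_const_mul, ← hp]
    refine integral_congr_ae (Eventually.of_forall fun ω => ?_)
    simp only [hazard]
    ring
  exact (mul_eq_zero.mp this).resolve_left E.rate_pos.ne'

/-- Integration against the joint law on the event that an `x̄`-buyer arrives in time. -/
theorem setIntegral_jointLaw (hReg : E.Regular) {φ : E.State → ℝ} (hφ : Continuous φ)
    {s : E.SellerType → ℝ≥0} (hs : Continuous s) :
    ∫ w in {w | w.2.2 ≤ (s w.2.1 : ℝ)}, φ w.1 ∂E.jointLaw = E.tradeIntegral φ s := by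
  have hA : MeasurableSet {w : E.State × E.SellerType × ℝ | w.2.2 ≤ (s w.2.1 : ℝ)} :=
    measurableSet_le (by fun_prop) (Continuous.measurable (by fun_prop))
  have hdens : ∀ w : E.State × E.SellerType × ℝ, E.density w.2.2 w.2.1 w.1 =
      if 0 ≤ w.2.2 then E.g w.2.1 w.1 * (E.hazard w.1 * Real.exp (-(E.hazard w.1 * w.2.2)))
      else 0 := by
    intro w
    simp only [density, f_eq_sig hReg, hazard]
    split_ifs <;> simp
  have hdnn : ∀ w : E.State × E.SellerType × ℝ, 0 ≤ E.density w.2.2 w.2.1 w.1 := by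
    intro w
    rw [hdens]
    split_ifs
    · exact mul_nonneg (g_pos_everywhere hReg _ _).le
        (mul_nonneg (hazard_pos _).le (Real.exp_pos _).le)
    · exact le_rfl
  have hdm : Measurable fun w : E.State × E.SellerType × ℝ => E.density w.2.2 w.2.1 w.1 := by
    simp only [hdens]
    exact Measurable.ite (measurableSet_le measurable_const (by fun_prop))
      (Continuous.measurable (by fun_prop)) measurable_const
  rw [jointLaw, setIntegral_withDensity_eq_setIntegral_toReal_smul (by fun_prop)
    (Eventually.of_forall fun w => ENNReal.ofReal_lt_top) _ hA, ← integral_indicator hA]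
  -- The density vanishes at negative times, so the event cuts time down to `[0, s y]`.
  have hind : ({w : E.State × E.SellerType × ℝ | w.2.2 ≤ (s w.2.1 : ℝ)}.indicator fun w =>
      (ENNReal.ofReal (E.density w.2.2 w.2.1 w.1)).toReal • φ w.1) = fun w =>
      (Set.Icc 0 (s w.2.1 : ℝ)).indicator (fun t => φ w.1 * E.g w.2.1 w.1 * E.hazard w.1 *
        Real.exp (-(E.hazard w.1 * t))) w.2.2 := by
    ext w
    simp only [Set.indicator_apply, Set.mem_ofPred_eq, ENNReal.toReal_ofReal (hdnn w),
      Set.mem_Icc, smul_eq_mul]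
    rw [hdens]
    by_cases h1 : 0 ≤ w.2.2 <;> by_cases h2 : w.2.2 ≤ (s w.2.1 : ℝ) <;> simp [h1, h2]
    ring
  rw [hind]
  have hc : Continuous fun w : E.State × E.SellerType × ℝ => φ w.1 * E.g w.2.1 w.1 *
      E.hazard w.1 * Real.exp (-(E.hazard w.1 * w.2.2)) := by fun_prop
  -- The time axis has infinite measure. Exit times are bounded by compactness of the type space, so
  -- the integrand lives on a box of finite measure, where it is bounded.
  obtain ⟨T, hT⟩ := isCompact_univ.exists_bound_of_continuousOn
    (f := fun y => (s y : ℝ)) (by fun_prop : Continuous fun y => (s y : ℝ)).continuousOn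
  obtain ⟨C, hC⟩ := ((isCompact_univ (X := E.State)).prod ((isCompact_univ (X := E.SellerType)).prod
    (isCompact_Icc (a := (0 : ℝ)) (b := T)))).exists_bound_of_continuousOn hc.continuousOn
  have hint : Integrable (fun w : E.State × E.SellerType × ℝ =>
      (Set.Icc 0 (s w.2.1 : ℝ)).indicator (fun t => φ w.1 * E.g w.2.1 w.1 * E.hazard w.1 *
        Real.exp (-(E.hazard w.1 * t))) w.2.2) (E.μ.prod (E.typeVolume.prod volume)) := by
    have hbox : Integrable ((Set.univ ×ˢ (Set.univ ×ˢ Set.Icc (0 : ℝ) T)).indicator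
        fun _ : E.State × E.SellerType × ℝ => C) (E.μ.prod (E.typeVolume.prod volume)) := by
      refine (integrable_indicator_iff
        (MeasurableSet.univ.prod (MeasurableSet.univ.prod measurableSet_Icc))).mpr ?_
      refine integrableOn_const ?_
      rw [Measure.prod_prod, Measure.prod_prod]
      exact ENNReal.mul_ne_top (measure_ne_top _ _)
        (ENNReal.mul_ne_top (measure_ne_top _ _) (by simp))
    refine hbox.mono' ?_ (Eventually.of_forall fun w => ?_)
    · refine Measurable.aestronglyMeasurable ?_
      have hA' : MeasurableSet {w : E.State × E.SellerType × ℝ |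
          w.2.2 ∈ Set.Icc 0 (s w.2.1 : ℝ)} :=
        (measurableSet_le (f := fun _ : E.State × E.SellerType × ℝ => (0 : ℝ))
          (g := fun w => w.2.2) measurable_const (by fun_prop)).inter hA
      exact hc.measurable.indicator hA'
    · by_cases hw : w.2.2 ∈ Set.Icc 0 (s w.2.1 : ℝ)
      · have hmem : w ∈ (Set.univ ×ˢ (Set.univ ×ˢ Set.Icc (0 : ℝ) T) :
            Set (E.State × E.SellerType × ℝ)) :=
          ⟨trivial, trivial, hw.1, hw.2.trans ((le_abs_self _).trans (hT _ (Set.mem_univ _)))⟩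
        rw [Set.indicator_of_mem hw, Set.indicator_of_mem hmem]
        exact hC w hmem
      · rw [Set.indicator_of_notMem hw, norm_zero]
        refine Set.indicator_nonneg (fun v hv => ?_) w
        exact (norm_nonneg _).trans (hC v hv)
  rw [integral_prod _ hint, tradeIntegral_eq_offerTime hφ hs]
  refine integral_congr_ae ?_
  filter_upwards [hint.prod_right_ae] with ω hω
  rw [integral_prod _ hω, offerTime, ← integral_const_mul, ← integral_const_mul]
  refine integral_congr_ae (Eventually.of_forall fun y => ?_)
  simp only
  rw [integral_indicator measurableSet_Icc, integral_Icc_eq_integral_Ioc,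
    ← intervalIntegral.integral_of_le (s y).coe_nonneg, intervalIntegral_const_mul_exp_neg (hazard_pos ω)]
  ring

namespace Standing

variable (h : E.Standing)
include h

/-- By continuity `s` is positive on an interval of types below the highest one, which has positive
length. -/
theorem offerTime_pos {s : E.SellerType → ℝ≥0} (hs : Continuous s) (hpos : 0 < s E.highType)
    (ω : E.State) : 0 < E.offerTime s ω := by
  have hc : Continuous fun y =>
      (1 - Real.exp (-(E.hazard ω * s y))) / E.hazard ω * E.g y ω := by fun_prop
  rw [offerTime, integral_pos_iff_support_of_nonneg _ hc.integrable_of_compactSpace]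
  · have hlow : E.lowType < E.highType := E.yLo_lt_yHi
    obtain ⟨c, hc, hsub⟩ := exists_Ioc_subset_of_mem_nhds
      (hs.continuousAt.eventually (lt_mem_nhds hpos)) ⟨_, hlow⟩
    refine (lebesgueOn_Ioi_pos (c := c) hc).trans_le (measure_mono fun y hy => ?_)
    have : 0 < s y := hsub ⟨hy, E.le_highType y⟩
    exact (mul_pos (div_pos (one_sub_exp_pos this ω) (hazard_pos ω)) (h.g_pos y ω)).ne'
  · exact fun y => mul_nonneg (div_nonneg (one_sub_exp_nonneg _ ω) (hazard_pos ω).le)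
      (h.g_pos y ω).le

theorem meanGivenTimeType_nonpos_iff (p : ℝ) (r : ℝ≥0) (y : E.SellerType) :
    E.meanGivenTimeType (fun ω => p - E.vS ω) r y ≤ 0 ↔ E.gain p r y ≤ 0 := by
  have hd : ∀ ω, E.density r y ω = E.g y ω * (E.hazard ω * Real.exp (-(E.hazard ω * r))) := by
    intro ω
    simp [density, f_eq_sig h.reg, hazard]
  have hpos : 0 < ∫ ω, E.density r y ω ∂E.μ := by
    simp only [hd]
    exact Continuous.integral_pos_of_forall_pos (by fun_prop) fun ω =>
      mul_pos (h.g_pos y ω) (mul_pos (hazard_pos ω) (Real.exp_pos _))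
  rw [meanGivenTimeType, div_le_iff₀ hpos, zero_mul, gain]
  simp only [hd, mul_assoc]

variable {s : E.SellerType → ℝ≥0} (hs : Continuous s) (hpos : 0 < s E.highType) {p : ℝ}
  (hp : E.tradeIntegral (fun ω => E.vB ω - p) s = 0)
include hs hpos

theorem tradeIntegral_one_pos : 0 < E.tradeIntegral (fun _ => 1) s := by
  rw [tradeIntegral_eq_offerTime continuous_const hs]
  have := continuous_offerTime hs
  exact Continuous.integral_pos_of_forall_pos (by fun_prop) fun ω =>
    mul_pos one_pos (mul_pos (hazard_pos ω) (h.offerTime_pos hs hpos ω))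

theorem integral_sig_offerTime_pos (x : E.X) : 0 < ∫ ω, E.sig x ω * E.offerTime s ω ∂E.μ := by
  have := continuous_offerTime hs
  exact Continuous.integral_pos_of_forall_pos (by fun_prop) fun ω =>
    mul_pos (sig_pos _ _) (h.offerTime_pos hs hpos ω)

/-- The weights have positive mass, so the sign of a buyer's profit from accepting `p` is that of
`passiveValue s x - p`. -/
theorem integral_value_sub_price (x : E.X) (p : ℝ) :
    ∫ ω, (E.vB ω - p) * (E.sig x ω * E.offerTime s ω) ∂E.μ =
      (E.passiveValue s x - p) * ∫ ω, E.sig x ω * E.offerTime s ω ∂E.μ := by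
  have := continuous_offerTime hs
  have hD := h.integral_sig_offerTime_pos hs hpos x
  rw [passiveValue_eq h.reg, sub_mul, div_mul_cancel₀ _ hD.ne', ← integral_const_mul,
    ← integral_sub (Continuous.integrable_of_compactSpace (by fun_prop))
      (Continuous.integrable_of_compactSpace (by fun_prop))]
  simp only [sub_mul]

include hp

theorem passiveValue_xbar : E.passiveValue s E.xbar = p := by
  have h1 := h.integral_value_sub_price hs hpos E.xbar p
  rw [integral_xbar_eq_zero hs hp] at h1
  have := (mul_eq_zero.mp h1.symm).resolve_right
    (h.integral_sig_offerTime_pos hs hpos E.xbar).ne'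
  linarith

/-- If a lower signal broke even at `p`, reweighting by the strictly increasing ratio `sig E.xbar /
sig x` would give the highest signal a strictly positive profit, which is in fact zero. -/
theorem passiveValue_lt {x : E.X} (hx : x ≠ E.xbar) : E.passiveValue s x < p := by
  have hcont := continuous_offerTime hs
  by_contra! hge
  have hne : ∀ ω, E.sig x ω ≠ 0 := fun ω => (sig_pos x ω).ne'
  have key := integral_mul_pos_of_strictMono (μ := E.μ) (φ := fun ω => E.vB ω - p)
    (w := fun ω => E.sig x ω * E.offerTime s ω)
    (m := fun ω => E.sig E.xbar ω / E.sig x ω) (by fun_prop)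
    (fun a b hab => sub_lt_sub_right (E.vB_strictMono hab) p)
    (fun ω' ω hω => (div_lt_div_iff₀ (sig_pos _ _) (sig_pos _ _)).mpr (sig_ratio hx hω))
    (fun ω => div_pos (sig_pos _ _) (sig_pos _ _))
    (fun ω => mul_pos (sig_pos _ _) (h.offerTime_pos hs hpos ω))
    (Continuous.integrable_of_compactSpace (by fun_prop))
    (Continuous.integrable_of_compactSpace (by fun_prop (disch := exact hne)))
    (measure_compl_singleton_ne_zero h.trade h.supp h.reg)
    (by
      rw [h.integral_value_sub_price hs hpos x p]
      exact mul_nonneg (sub_nonneg.mpr hge) (h.integral_sig_offerTime_pos hs hpos x).le)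
  refine key.ne' ?_
  rw [← integral_xbar_eq_zero hs hp]
  refine integral_congr_ae (Eventually.of_forall fun ω => ?_)
  have := hne ω
  simp only
  field_simp

/-- Numerator and normalizer of the conditional expectation are both trade integrals, and the
zero-profit condition fixes their ratio. -/
theorem meanGivenTrade_vB : E.meanGivenTrade E.vB s = p := by
  have hone := setIntegral_jointLaw h.reg (φ := fun _ => (1 : ℝ)) continuous_const hs
  have hv := setIntegral_jointLaw h.reg E.vB_continuous hs
  have h1 := h.tradeIntegral_one_pos hs hpos
  simp only [integral_const, smul_eq_mul, mul_one, measureReal_def,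
    Measure.restrict_apply_univ] at hone
  rw [meanGivenTrade, ProbabilityTheory.cond, integral_smul_measure, ENNReal.toReal_inv, hone, hv,
    smul_eq_mul, inv_mul_eq_div, div_eq_iff h1.ne']
  have hcont := continuous_offerTime hs
  rw [tradeIntegral_eq_offerTime (by fun_prop) hs] at hp ⊢
  rw [tradeIntegral_eq_offerTime (by fun_prop) hs, ← integral_const_mul, ← sub_eq_zero,
    ← integral_sub (Continuous.integrable_of_compactSpace (by fun_prop))
      (Continuous.integrable_of_compactSpace (by fun_prop)), ← hp]
  refine integral_congr_ae (Eventually.of_forall fun ω => ?_)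
  simp only
  ring

/-- The price is a weighted mean of `vB`, hence feasible. -/
theorem price_mem : p ∈ Set.Icc (⨅ ω, E.vB ω) (⨆ ω, E.vB ω) := by
  have hcont := continuous_offerTime hs
  have hw : ∀ ω, 0 < E.sig E.xbar ω * E.offerTime s ω := fun ω =>
    mul_pos (sig_pos _ _) (h.offerTime_pos hs hpos ω)
  have h0 := integral_xbar_eq_zero hs hp
  constructor
  · by_contra! hlt
    refine (Continuous.integral_pos_of_forall_pos (μ := E.μ) ?_ fun ω =>
      mul_pos (sub_pos.mpr (hlt.trans_le (ciInf_le ?_ ω))) (hw ω)).ne' h0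
    · fun_prop
    · exact (isCompact_range E.vB_continuous).bddBelow
  · by_contra! hlt
    have := Continuous.integral_pos_of_forall_pos (μ := E.μ)
      (f := fun ω => -((E.vB ω - p) * (E.sig E.xbar ω * E.offerTime s ω))) (by fun_prop) fun ω =>
      neg_pos.mpr (mul_neg_of_neg_of_pos (sub_neg.mpr
        ((le_ciSup (isCompact_range E.vB_continuous).bddAbove ω).trans_lt hlt)) (hw ω))
    rw [integral_neg, h0, neg_zero] at this
    exact lt_irrefl _ this

end Standing

end Market

/-! ### Measurability and payoffs -/

/-- Moving the variable end points into an indicator reduces this to a parametric integral over a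
fixed domain. -/
theorem measurable_intervalIntegral {β : Type*} [MeasurableSpace β] {F : β → ℝ → ℝ}
    (hF : Measurable (Function.uncurry F)) {a b : β → ℝ} (ha : Measurable a) (hb : Measurable b) :
    Measurable fun x => ∫ r in a x..b x, F x r := by
  have key : ∀ {a b : β → ℝ}, Measurable a → Measurable b →
      Measurable fun x => ∫ r in Set.Ioc (a x) (b x), F x r := by
    intro a b ha hb
    have hm : Measurable (Function.uncurry fun x r => (Set.Ioc (a x) (b x)).indicator (F x) r) := by
      have hset : MeasurableSet {w : β × ℝ | w.2 ∈ Set.Ioc (a w.1) (b w.1)} :=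
        (measurableSet_lt (f := fun w : β × ℝ => a w.1) (g := fun w => w.2)
          (by fun_prop) (by fun_prop)).inter
        (measurableSet_le (f := fun w : β × ℝ => w.2) (g := fun w => b w.1)
          (by fun_prop) (by fun_prop))
      exact hF.indicator hset
    have := hm.stronglyMeasurable.integral_prod_right (ν := (volume : Measure ℝ))
    simpa only [integral_indicator measurableSet_Ioc] using this.measurable
  exact (key ha hb).sub (key hb ha)

theorem intervalIntegral_ite_le {s H : ℝ} (hs : 0 ≤ s) (hH : s ≤ H) (F : ℝ → ℝ) :
    ∫ t in (0 : ℝ)..H, (if t ≤ s then F t else 0) = ∫ t in (0 : ℝ)..s, F t := by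
  rw [← intervalIntegral.integral_indicator (a₂ := s) (a₃ := H) ⟨hs, hH⟩]
  simp only [Set.indicator_apply, Set.mem_ofPred_eq]

namespace Market

variable {E : Market} {M : Type*} [MeasurableSpace M]

section General

variable (α : E.BuyerStrategy M) (σ : E.SellerStrategy M)

theorem measurable_acceptProb : Measurable fun w : ℝ × E.SellerType × unitInterval × E.State =>
    acceptProb α σ w.1 w.2.1 w.2.2.1 w.2.2.2 := by
  have hw : Measurable fun w : ℝ × E.SellerType × unitInterval × E.State =>
      (w.1, w.2.1, w.2.2.1) := by fun_prop
  unfold acceptProb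
  refine Measurable.mul ?_ (Finset.measurable_sum _ fun x _ => Measurable.mul ?_ ?_)
  · exact Measurable.ite ((σ.measurable_offer.comp hw) (measurableSet_singleton true))
      measurable_const measurable_const
  · exact (E.f_continuous x).measurable.comp
      (by fun_prop : Measurable fun w : ℝ × E.SellerType × unitInterval × E.State =>
        (w.2.1, w.2.2.2))
  · exact measurable_subtype_coe.comp (α.measurable_accept.comp (measurable_const.prodMk
      ((σ.measurable_price.comp hw).prodMk (σ.measurable_message.comp hw))))

theorem acceptProb_nonneg (t : ℝ) (y : E.SellerType) (z : unitInterval) (ω : E.State) :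
    0 ≤ acceptProb α σ t y z ω := by
  refine mul_nonneg (by split_ifs <;> simp) (Finset.sum_nonneg fun x _ => ?_)
  exact mul_nonneg (E.f_pos _ _ _).le (α.accept _).2.1

theorem acceptProb_le_one (t : ℝ) (y : E.SellerType) (z : unitInterval) (ω : E.State) :
    acceptProb α σ t y z ω ≤ 1 := by
  have h1 : ∑ x, E.f x y ω * (α.accept (x, σ.price (t, y, z), σ.message (t, y, z)) : ℝ) ≤ 1 := by
    rw [← E.f_sum y ω]
    exact Finset.sum_le_sum fun x _ => mul_le_of_le_one_right (E.f_pos _ _ _).le (α.accept _).2.2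
  have h0 : 0 ≤ ∑ x, E.f x y ω * (α.accept (x, σ.price (t, y, z), σ.message (t, y, z)) : ℝ) :=
    Finset.sum_nonneg fun x _ => mul_nonneg (E.f_pos _ _ _).le (α.accept _).2.1
  unfold acceptProb
  split_ifs
  · rwa [one_mul]
  · simp

theorem measurable_tradeRate : Measurable fun w : ℝ × E.SellerType × unitInterval × E.State =>
    tradeRate α σ w.1 w.2.1 w.2.2.1 w.2.2.2 :=
  (measurable_acceptProb α σ).const_mul _

theorem measurable_tradeRate_time (y : E.SellerType) (z : unitInterval) (ω : E.State) :
    Measurable fun t => tradeRate α σ t y z ω :=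
  (measurable_tradeRate α σ).comp (by fun_prop : Measurable fun t : ℝ => (t, y, z, ω))

theorem tradeRate_nonneg (t : ℝ) (y : E.SellerType) (z : unitInterval) (ω : E.State) :
    0 ≤ tradeRate α σ t y z ω := mul_nonneg E.rate_pos.le (acceptProb_nonneg ..)

theorem tradeRate_le (t : ℝ) (y : E.SellerType) (z : unitInterval) (ω : E.State) :
    tradeRate α σ t y z ω ≤ E.rate :=
  mul_le_of_le_one_right E.rate_pos.le (acceptProb_le_one ..)

theorem intervalIntegrable_tradeRate (y : E.SellerType) (z : unitInterval) (ω : E.State)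
    (a b : ℝ) : IntervalIntegrable (fun t => tradeRate α σ t y z ω) volume a b := by
  refine (intervalIntegrable_const (c := E.rate)).mono_fun
    (measurable_tradeRate_time α σ y z ω).aestronglyMeasurable
    (Eventually.of_forall fun t => ?_)
  change ‖tradeRate α σ t y z ω‖ ≤ ‖E.rate‖
  rw [Real.norm_of_nonneg (tradeRate_nonneg ..), Real.norm_of_nonneg E.rate_pos.le]
  exact tradeRate_le ..

theorem measurable_survival : Measurable fun w : ℝ × E.SellerType × unitInterval × E.State =>
    survival α σ w.1 w.2.1 w.2.2.1 w.2.2.2 := by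
  have hm : Measurable (Function.uncurry
      fun (w : ℝ × E.SellerType × unitInterval × E.State) (r : ℝ) =>
        tradeRate α σ r w.2.1 w.2.2.1 w.2.2.2) :=
    (measurable_tradeRate α σ).comp
      (by fun_prop : Measurable fun w : (ℝ × E.SellerType × unitInterval × E.State) × ℝ =>
        (w.2, w.1.2.1, w.1.2.2.1, w.1.2.2.2))
  exact (measurable_intervalIntegral hm measurable_const measurable_fst).neg.exp

theorem integral_tradeRate_mul_survival (H : ℝ) (y : E.SellerType) (z : unitInterval)
    (ω : E.State) : ∫ t in (0 : ℝ)..H, tradeRate α σ t y z ω * survival α σ t y z ω =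
      1 - survival α σ H y z ω :=
  integral_hazard_mul_survival (measurable_tradeRate_time α σ y z ω)
    (fun t => tradeRate_nonneg α σ t y z ω) (fun t => tradeRate_le α σ t y z ω) H

theorem survival_pos (t : ℝ) (y : E.SellerType) (z : unitInterval) (ω : E.State) :
    0 < survival α σ t y z ω := Real.exp_pos _

/-- The seller's flow payoff. -/
noncomputable def sellerFlow (t : ℝ) (y : E.SellerType) (z : unitInterval) (ω : E.State) : ℝ :=
  ((σ.price (t, y, z) : ℝ) - E.vS ω) * tradeRate α σ t y z ω * survival α σ t y z ω

theorem measurable_sellerFlow : Measurable fun w : ℝ × E.SellerType × unitInterval × E.State =>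
    sellerFlow α σ w.1 w.2.1 w.2.2.1 w.2.2.2 := by
  have hw : Measurable fun w : ℝ × E.SellerType × unitInterval × E.State =>
      (w.1, w.2.1, w.2.2.1) := by fun_prop
  have hp : Measurable fun w : ℝ × E.SellerType × unitInterval × E.State =>
      (σ.price (w.1, w.2.1, w.2.2.1) : ℝ) :=
    measurable_subtype_coe.comp (σ.measurable_price.comp hw)
  have hv : Measurable fun w : ℝ × E.SellerType × unitInterval × E.State => E.vS w.2.2.2 :=
    E.vS_continuous.measurable.comp (by fun_prop)
  exact ((hp.sub hv).mul (measurable_tradeRate α σ)).mul (measurable_survival α σ)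

theorem measurable_sellerFlow_time (y : E.SellerType) (z : unitInterval) (ω : E.State) :
    Measurable fun t => sellerFlow α σ t y z ω :=
  (measurable_sellerFlow α σ).comp (by fun_prop : Measurable fun t : ℝ => (t, y, z, ω))

theorem exists_margin_bound (E : Market) :
    ∃ C : ℝ, 0 ≤ C ∧ ∀ (p : E.Price) (ω : E.State), |(p : ℝ) - E.vS ω| ≤ C := by
  obtain ⟨C, hC⟩ := ((isCompact_univ (X := E.Price)).prod
    (isCompact_univ (X := E.State))).exists_bound_of_continuousOn
    (f := fun w : E.Price × E.State => (w.1 : ℝ) - E.vS w.2) (by fun_prop)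
  exact ⟨max C 0, le_max_right _ _, fun p ω =>
    (hC (p, ω) ⟨trivial, trivial⟩).trans (le_max_left _ _)⟩

theorem intervalIntegrable_mul_survival (y : E.SellerType) (z : unitInterval) (ω : E.State)
    (H : ℝ) : IntervalIntegrable
      (fun t => tradeRate α σ t y z ω * survival α σ t y z ω) volume 0 H := by
  have hc : Continuous fun t => survival α σ t y z ω :=
    (intervalIntegral.continuous_primitive
      (intervalIntegrable_tradeRate α σ y z ω) 0).neg.rexp
  exact (intervalIntegrable_tradeRate α σ y z ω 0 H).mul_continuousOn hc.continuousOn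

theorem norm_sellerFlow_le {C : ℝ} (hC : ∀ (p : E.Price) (ω : E.State), |(p : ℝ) - E.vS ω| ≤ C)
    (t : ℝ) (y : E.SellerType) (z : unitInterval) (ω : E.State) :
    ‖sellerFlow α σ t y z ω‖ ≤ C * (tradeRate α σ t y z ω * survival α σ t y z ω) := by
  have h1 := mul_nonneg (tradeRate_nonneg α σ t y z ω) (survival_pos α σ t y z ω).le
  rw [sellerFlow, mul_assoc, norm_mul, Real.norm_of_nonneg h1]
  exact mul_le_mul_of_nonneg_right (hC _ _) h1

theorem intervalIntegrable_sellerFlow (y : E.SellerType) (z : unitInterval) (ω : E.State) (H : ℝ) :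
    IntervalIntegrable (fun t => sellerFlow α σ t y z ω) volume 0 H := by
  obtain ⟨C, -, hC⟩ := E.exists_margin_bound
  refine ((intervalIntegrable_mul_survival α σ y z ω H).const_mul C).mono_fun
    (measurable_sellerFlow_time α σ y z ω).aestronglyMeasurable (Eventually.of_forall fun t => ?_)
  exact (norm_sellerFlow_le α σ hC t y z ω).trans (le_abs_self _)

/-- Trade rate times survival is the density of the time of trade, of mass at most one. The bound is
uniform in the horizon, which yields both integrability over all times and domination in the limit.
-/
theorem integral_norm_sellerFlow_le {C : ℝ} (hC0 : 0 ≤ C)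
    (hC : ∀ (p : E.Price) (ω : E.State), |(p : ℝ) - E.vS ω| ≤ C) {H : ℝ} (hH : 0 ≤ H)
    (y : E.SellerType) (z : unitInterval) (ω : E.State) :
    ∫ t in (0 : ℝ)..H, ‖sellerFlow α σ t y z ω‖ ≤ C :=
  calc ∫ t in (0 : ℝ)..H, ‖sellerFlow α σ t y z ω‖
      ≤ ∫ t in (0 : ℝ)..H, C * (tradeRate α σ t y z ω * survival α σ t y z ω) :=
        intervalIntegral.integral_mono_on hH (intervalIntegrable_sellerFlow α σ y z ω H).norm
          ((intervalIntegrable_mul_survival α σ y z ω H).const_mul C)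
          fun t _ => norm_sellerFlow_le α σ hC t y z ω
    _ = C * (1 - survival α σ H y z ω) := by
        rw [intervalIntegral.integral_const_mul, integral_tradeRate_mul_survival]
    _ ≤ C := mul_le_of_le_one_right hC0 (by linarith [survival_pos α σ H y z ω])

/-- The seller's payoff up to the horizon given type, randomization and state. -/
noncomputable def sellerValue (H : ℝ) (w : E.State × E.SellerType × unitInterval) : ℝ :=
  ∫ t in (0 : ℝ)..H, sellerFlow α σ t w.2.1 w.2.2 w.1

theorem measurable_sellerValue (H : ℝ) : Measurable (sellerValue α σ H) := by
  have hm : Measurable (Function.uncurry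
      fun (w : E.State × E.SellerType × unitInterval) (t : ℝ) =>
        sellerFlow α σ t w.2.1 w.2.2 w.1) :=
    (measurable_sellerFlow α σ).comp
      (by fun_prop : Measurable fun w : (E.State × E.SellerType × unitInterval) × ℝ =>
        (w.2, w.1.2.1, w.1.2.2, w.1.1))
  exact measurable_intervalIntegral hm measurable_const measurable_const

theorem norm_sellerValue_le {C : ℝ} (hC0 : 0 ≤ C)
    (hC : ∀ (p : E.Price) (ω : E.State), |(p : ℝ) - E.vS ω| ≤ C) {H : ℝ} (hH : 0 ≤ H)
    (w : E.State × E.SellerType × unitInterval) : ‖sellerValue α σ H w‖ ≤ C :=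
  (intervalIntegral.norm_integral_le_integral_norm hH).trans
    (integral_norm_sellerFlow_le α σ hC0 hC hH _ _ _)

/-- The reference measure on states, types and randomization devices. -/
noncomputable abbrev referenceMeasure (E : Market) :
    Measure (E.State × E.SellerType × unitInterval) :=
  E.μ.prod (E.typeVolume.prod volume)

theorem integrable_mul_density {B : E.State × E.SellerType × unitInterval → ℝ} (hB : Measurable B)
    {C : ℝ} (hC : ∀ w, ‖B w‖ ≤ C) :
    Integrable (fun w => B w * E.g w.2.1 w.1) E.referenceMeasure := by
  have hg : Continuous fun w : E.State × E.SellerType × unitInterval => E.g w.2.1 w.1 := by fun_prop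
  exact (hg.integrable_of_compactSpace).bdd_mul hB.aestronglyMeasurable
    (Eventually.of_forall hC)

theorem iterated_integral_eq {B : E.State × E.SellerType × unitInterval → ℝ} (hB : Measurable B)
    {C : ℝ} (hC : ∀ w, ‖B w‖ ≤ C) :
    ∫ ω, ∫ y, (∫ z : unitInterval, B (ω, y, z)) * E.g y ω ∂E.typeVolume ∂E.μ =
      ∫ w, B w * E.g w.2.1 w.1 ∂E.referenceMeasure := by
  have hint := integrable_mul_density hB hC
  rw [integral_prod _ hint]
  refine integral_congr_ae ?_
  filter_upwards [hint.prod_right_ae] with ω hω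
  rw [integral_prod _ hω]
  simp only [integral_mul_const]

theorem sellerPayoff_eq {H : ℝ} (hH : 0 ≤ H) :
    sellerPayoff α σ H = ∫ w, sellerValue α σ H w * E.g w.2.1 w.1 ∂E.referenceMeasure := by
  obtain ⟨C, hC0, hC⟩ := E.exists_margin_bound
  exact iterated_integral_eq (measurable_sellerValue α σ H)
    (norm_sellerValue_le α σ hC0 hC hH)

/-- The seller's payoff converges as the horizon grows. -/
theorem exists_isSellerUtility : ∃ u, IsSellerUtility α σ u := by
  obtain ⟨C, hC0, hC⟩ := E.exists_margin_bound
  refine ⟨∫ w, (∫ t in Set.Ioi (0 : ℝ), sellerFlow α σ t w.2.1 w.2.2 w.1) * E.g w.2.1 w.1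
    ∂E.referenceMeasure, ?_⟩
  have key : Tendsto (fun H => ∫ w, sellerValue α σ H w * E.g w.2.1 w.1 ∂E.referenceMeasure) atTop
      (𝓝 (∫ w, (∫ t in Set.Ioi (0 : ℝ), sellerFlow α σ t w.2.1 w.2.2 w.1) * E.g w.2.1 w.1
        ∂E.referenceMeasure)) := by
    have hg : Continuous fun w : E.State × E.SellerType × unitInterval => E.g w.2.1 w.1 := by
      fun_prop
    refine tendsto_integral_filter_of_dominated_convergence (fun w => C * ‖E.g w.2.1 w.1‖) ?_ ?_ ?_ ?_
    · exact Eventually.of_forall fun H =>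
        ((measurable_sellerValue α σ H).mul hg.measurable).aestronglyMeasurable
    · filter_upwards [eventually_ge_atTop 0] with H hH
      refine Eventually.of_forall fun w => ?_
      rw [norm_mul]
      exact mul_le_mul_of_nonneg_right (norm_sellerValue_le α σ hC0 hC hH w) (norm_nonneg _)
    · exact Continuous.integrable_of_compactSpace (by fun_prop)
    · refine Eventually.of_forall fun w => Tendsto.mul_const _ ?_
      refine intervalIntegral_tendsto_integral_Ioi 0 ?_ tendsto_id
      refine integrableOn_Ioi_of_intervalIntegral_norm_bounded C 0 (l := atTop) (b := id)
        (fun H => ?_) tendsto_id ?_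
      · rcases le_total 0 H with hH | hH
        · exact (intervalIntegrable_iff_integrableOn_Ioc_of_le hH).mp
            (intervalIntegrable_sellerFlow α σ _ _ _ H)
        · simp [Set.Ioc_eq_empty_of_le hH]
      · filter_upwards [eventually_ge_atTop 0] with H hH
        exact integral_norm_sellerFlow_le α σ hC0 hC hH _ _ _
  refine key.congr' ?_
  filter_upwards [eventually_ge_atTop 0] with H hH
  exact (sellerPayoff_eq α σ hH).symm

end General

end Market

/-! ### Optimality of the seller's stopping strategy -/

namespace Market

variable {E : Market} {M : Type*} [MeasurableSpace M]

section MonotoneHazard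

variable (α : E.BuyerStrategy M) (σ : E.SellerStrategy M)

/-- The total hazard of trade up to time `H`. -/
noncomputable def totalHazard (H : ℝ) (y : E.SellerType) (z : unitInterval) (ω : E.State) : ℝ :=
  ∫ t in (0 : ℝ)..H, tradeRate α σ t y z ω

theorem totalHazard_nonneg {H : ℝ} (hH : 0 ≤ H) (y : E.SellerType) (z : unitInterval)
    (ω : E.State) : 0 ≤ totalHazard α σ H y z ω :=
  intervalIntegral.integral_nonneg hH fun t _ => tradeRate_nonneg α σ t y z ω

/-- Relative to the hazard of `x̄`-buyers, the hazard of trade is weakly decreasing in the state. -/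
theorem totalHazard_ratio (hReg : E.Regular) {H : ℝ} (hH : 0 ≤ H) (y : E.SellerType)
    (z : unitInterval) {ω ω' : E.State} (hω : ω' ≤ ω) :
    totalHazard α σ H y z ω * E.hazard ω' ≤ totalHazard α σ H y z ω' * E.hazard ω := by
  rw [totalHazard, totalHazard, ← intervalIntegral.integral_mul_const,
    ← intervalIntegral.integral_mul_const]
  refine intervalIntegral.integral_mono_on hH
    ((intervalIntegrable_tradeRate α σ y z ω 0 H).mul_const _)
    ((intervalIntegrable_tradeRate α σ y z ω' 0 H).mul_const _) fun t _ => ?_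
  simp only [tradeRate, acceptProb, hazard, f_eq_sig hReg]
  set o : ℝ := if σ.offer (t, y, z) = true then 1 else 0 with ho
  have ho0 : 0 ≤ o := by rw [ho]; split_ifs <;> simp
  -- The comparison holds signal by signal, whatever the acceptance probabilities.
  have hsum : (∑ x, E.sig x ω * (α.accept (x, σ.price (t, y, z), σ.message (t, y, z)) : ℝ)) *
      E.sig E.xbar ω' ≤
      (∑ x, E.sig x ω' * (α.accept (x, σ.price (t, y, z), σ.message (t, y, z)) : ℝ)) *
      E.sig E.xbar ω := by
    rw [Finset.sum_mul, Finset.sum_mul]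
    refine Finset.sum_le_sum fun x _ => ?_
    have := mul_le_mul_of_nonneg_right (sig_ratio_le x hω)
      (α.accept (x, σ.price (t, y, z), σ.message (t, y, z))).2.1
    linarith
  have := mul_le_mul_of_nonneg_left hsum
    (mul_nonneg (mul_nonneg E.rate_pos.le E.rate_pos.le) ho0)
  linarith

/-- If prices above `p` are rejected, the seller's payoff is at most that of selling at `p` with the
same probability. -/
theorem sellerValue_le {p : ℝ} (hα : ∀ x (q : E.Price) m, p < q → (α.accept (x, q, m) : ℝ) = 0)
    {H : ℝ} (hH : 0 ≤ H) (w : E.State × E.SellerType × unitInterval) :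
    sellerValue α σ H w ≤
      (p - E.vS w.1) * (1 - Real.exp (-totalHazard α σ H w.2.1 w.2.2 w.1)) := by
  have h1 := integral_tradeRate_mul_survival α σ H w.2.1 w.2.2 w.1
  rw [survival] at h1
  rw [totalHazard, ← h1, ← intervalIntegral.integral_const_mul, sellerValue]
  refine intervalIntegral.integral_mono_on hH (intervalIntegrable_sellerFlow α σ _ _ _ H)
    ((intervalIntegrable_mul_survival α σ _ _ _ H).const_mul _) fun t _ => ?_
  rw [sellerFlow, mul_assoc]
  have h2 := mul_nonneg (tradeRate_nonneg α σ t w.2.1 w.2.2 w.1)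
    (survival_pos α σ t w.2.1 w.2.2 w.1).le
  by_cases hp : (σ.price (t, w.2.1, w.2.2) : ℝ) ≤ p
  · exact mul_le_mul_of_nonneg_right (by linarith) h2
  · have : tradeRate α σ t w.2.1 w.2.2 w.1 = 0 := by
      simp [tradeRate, acceptProb, hα _ _ _ (not_le.mp hp)]
    simp [this]

end MonotoneHazard

namespace Standing

variable (h : E.Standing) {p : ℝ} (hp : p < E.vS E.lowState)
include h hp

theorem gain_nonpos_of_exitTime_le {y : E.SellerType} {r : ℝ} (hr : E.exitTime p y ≤ r) :
    E.gain p r y ≤ 0 := by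
  by_contra! hpos
  have h1 : (⟨r, (NNReal.coe_nonneg _).trans hr⟩ : ℝ≥0) < E.exitTime p y :=
    (h.lt_exitTime_iff hp).mpr hpos
  exact absurd hr (not_le.mpr (NNReal.coe_lt_coe.mpr h1))

/-- The hypothesis `hne` excludes types that never wish to sell, whose gain at time zero may be
negative. -/
theorem gain_nonneg_of_le_exitTime {y : E.SellerType} (hne : E.exitTime p y ≠ 0) {r : ℝ}
    (hr : r ≤ E.exitTime p y) : 0 ≤ E.gain p r y := by
  rcases hr.eq_or_lt with rfl | hlt
  · exact h.gain_exitTime_nonneg hp hne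
  · exact (h.gain_pos_of_lt_time hlt (h.gain_exitTime_nonneg hp hne)).le

/-- The exit time is the optimal time to stop selling to `x̄`-buyers at the price `p`. -/
theorem stopping_optimal (y : E.SellerType) {R : ℝ} (hR : 0 ≤ R) :
    ∫ ω, (p - E.vS ω) * E.g y ω * (1 - Real.exp (-(E.hazard ω * R))) ∂E.μ ≤
      ∫ ω, (p - E.vS ω) * E.g y ω * (1 - Real.exp (-(E.hazard ω * E.exitTime p y))) ∂E.μ := by
  have hswap := intervalIntegral_integral_mul_exp (μ := E.μ)
    (ψ := fun ω => (p - E.vS ω) * E.g y ω) (k := E.hazard) (by fun_prop) (by fun_prop) R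
    (E.exitTime p y)
  rw [← sub_nonneg, ← integral_sub (Continuous.integrable_of_compactSpace (by fun_prop))
    (Continuous.integrable_of_compactSpace (by fun_prop))]
  -- The payoff difference between two stopping times is the integral of `gain` between them, and
  -- `gain` has a constant sign on each side of the exit time.
  have heq : ∫ ω, ((p - E.vS ω) * E.g y ω * (1 - Real.exp (-(E.hazard ω * E.exitTime p y))) -
      (p - E.vS ω) * E.g y ω * (1 - Real.exp (-(E.hazard ω * R)))) ∂E.μ =
      ∫ r in R..E.exitTime p y, E.gain p r y := by
    simp only [gain]
    rw [hswap]
    refine integral_congr_ae (Eventually.of_forall fun ω => ?_)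
    simp only
    ring
  rw [heq]
  rcases le_total R (E.exitTime p y) with hle | hle
  · by_cases hne : E.exitTime p y = 0
    · rw [hne] at hle ⊢
      rw [le_antisymm hle hR]
      simp
    · exact intervalIntegral.integral_nonneg hle fun r hr =>
        h.gain_nonneg_of_le_exitTime hp hne hr.2
  · rw [intervalIntegral.integral_symm, neg_nonneg, ← neg_nonneg, ← intervalIntegral.integral_neg]
    exact intervalIntegral.integral_nonneg hle fun r hr =>
      neg_nonneg.mpr (h.gain_nonpos_of_exitTime_le hp hr.1)

/-- The margin is negative at the lowest state, but not everywhere, since the highest type gains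
from trade. -/
theorem exists_breakeven_state (hgain : 0 < E.gain p 0 E.highType) :
    ∃ ω, p - E.vS ω = 0 := by
  rcases forall_pos_or_forall_neg_or_exists_zero (φ := fun ω => p - E.vS ω) (by fun_prop)
    with h1 | h1 | h1
  · exact absurd (h1 E.lowState) (not_lt.mpr (sub_neg.mpr hp).le)
  · refine absurd hgain (not_lt.mpr (integral_nonpos fun ω => ?_))
    exact mul_nonpos_of_nonpos_of_nonneg
      (mul_nonpos_of_nonpos_of_nonneg (h1 ω).le (h.g_pos _ _).le)
      (mul_pos (hazard_pos _) (Real.exp_pos _)).le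
  · exact h1

/-- No strategy of the seller yields more, given the type and the randomization, than selling to
`x̄`-buyers at price `p` until the exit time. -/
theorem integral_sellerValue_le (hgain : 0 < E.gain p 0 E.highType)
    {α : E.BuyerStrategy M} (hα : ∀ x (q : E.Price) m, p < q → (α.accept (x, q, m) : ℝ) = 0)
    (σ : E.SellerStrategy M) {H : ℝ} (hH : 0 ≤ H) (y : E.SellerType) (z : unitInterval) :
    ∫ ω, sellerValue α σ H (ω, y, z) * E.g y ω ∂E.μ ≤
      ∫ ω, (p - E.vS ω) * E.g y ω * (1 - Real.exp (-(E.hazard ω * E.exitTime p y))) ∂E.μ := by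
  obtain ⟨ω₀, hω₀⟩ := h.exists_breakeven_state hp hgain
  -- At the break-even state, serving highest-signal buyers up to `R` has the same total hazard as
  -- `σ`. By the falling hazard ratio, `σ` trades at least as likely in lower states, where a sale
  -- loses, and at most as likely in higher states, where it gains.
  set R := totalHazard α σ H y z ω₀ / E.hazard ω₀ with hRdef
  have hR : 0 ≤ R := div_nonneg (totalHazard_nonneg α σ hH y z ω₀) (hazard_pos ω₀).le
  have hR0 : totalHazard α σ H y z ω₀ = R * E.hazard ω₀ := (div_mul_cancel₀ _ (hazard_pos _).ne').symm
  refine le_trans ?_ (h.stopping_optimal hp y hR)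
  obtain ⟨C, hC0, hC⟩ := E.exists_margin_bound
  refine integral_mono ?_ (Continuous.integrable_of_compactSpace (by fun_prop)) fun ω => ?_
  · have hg : Continuous fun ω => E.g y ω := by fun_prop
    exact (hg.integrable_of_compactSpace).bdd_mul
      ((measurable_sellerValue α σ H).comp
        (by fun_prop : Measurable fun ω : E.State => (ω, y, z))).aestronglyMeasurable
      (Eventually.of_forall fun ω => norm_sellerValue_le α σ hC0 hC hH (ω, y, z))
  · have h1 := sellerValue_le α σ hα hH (ω, y, z)
    have h2 : (p - E.vS ω) * (1 - Real.exp (-totalHazard α σ H y z ω)) ≤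
        (p - E.vS ω) * (1 - Real.exp (-(E.hazard ω * R))) := by
      rcases le_total ω ω₀ with hle | hle
      · have hneg : p - E.vS ω ≤ 0 := by
          have := h.reg.vS_strictAnti.antitone hle
          linarith
        have hQ := totalHazard_ratio α σ h.reg hH y z hle
        rw [hR0] at hQ
        have hQ' : E.hazard ω * R ≤ totalHazard α σ H y z ω := by
          have : E.hazard ω * R * E.hazard ω₀ ≤ totalHazard α σ H y z ω * E.hazard ω₀ := by linarith
          exact le_of_mul_le_mul_right this (hazard_pos _)
        refine mul_le_mul_of_nonpos_left (sub_le_sub_left (Real.exp_le_exp.mpr ?_) _) hneg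
        linarith
      · have hnn : 0 ≤ p - E.vS ω := by
          have := h.reg.vS_strictAnti.antitone hle
          linarith
        have hQ := totalHazard_ratio α σ h.reg hH y z hle
        rw [hR0] at hQ
        have hQ' : totalHazard α σ H y z ω ≤ E.hazard ω * R := by
          have : totalHazard α σ H y z ω * E.hazard ω₀ ≤ E.hazard ω * R * E.hazard ω₀ := by linarith
          exact le_of_mul_le_mul_right this (hazard_pos _)
        refine mul_le_mul_of_nonneg_left (sub_le_sub_left (Real.exp_le_exp.mpr ?_) _) hnn
        linarith
    have h3 := mul_le_mul_of_nonneg_right (h1.trans h2) (h.g_pos y ω).le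
    simp only at h3 ⊢
    linarith

/-- The bound holds for each type and each realization of the randomization device, so it survives
averaging over both. -/
theorem sellerPayoff_le (hgain : 0 < E.gain p 0 E.highType)
    {α : E.BuyerStrategy M} (hα : ∀ x (q : E.Price) m, p < q → (α.accept (x, q, m) : ℝ) = 0)
    (σ : E.SellerStrategy M) {H : ℝ} (hH : 0 ≤ H) :
    sellerPayoff α σ H ≤ E.tradeIntegral (fun ω => p - E.vS ω) (E.exitTime p) := by
  obtain ⟨C, hC0, hC⟩ := E.exists_margin_bound
  have hint := integrable_mul_density (measurable_sellerValue α σ H)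
    (norm_sellerValue_le α σ hC0 hC hH)
  rw [sellerPayoff_eq α σ hH, integral_prod_symm _ hint]
  have hs := h.continuous_exitTime hp
  have hKc : Continuous fun y => ∫ ω, (p - E.vS ω) * E.g y ω *
      (1 - Real.exp (-(E.hazard ω * E.exitTime p y))) ∂E.μ := by
    refine continuous_integral_of_compactSpace ?_
    unfold Function.uncurry
    fun_prop
  have hK : E.tradeIntegral (fun ω => p - E.vS ω) (E.exitTime p) =
      ∫ v : E.SellerType × unitInterval, (∫ ω, (p - E.vS ω) * E.g v.1 ω *
        (1 - Real.exp (-(E.hazard ω * E.exitTime p v.1))) ∂E.μ) ∂(E.typeVolume.prod volume) := by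
    rw [integral_fun_fst (fun y => ∫ ω, (p - E.vS ω) * E.g y ω *
      (1 - Real.exp (-(E.hazard ω * E.exitTime p y))) ∂E.μ)]
    simp [tradeIntegral]
  rw [hK]
  exact integral_mono hint.integral_prod_right
    (Continuous.integrable_of_compactSpace (hKc.comp continuous_fst))
    fun v => h.integral_sellerValue_le hp hgain hα σ hH v.1 v.2

end Standing

/-! ### The equilibrium strategies -/

/-- The seller offers the good at price `p` up to the exit time. -/
noncomputable def stoppingStrategy (p : E.Price) {s : E.SellerType → ℝ≥0} (hs : Continuous s)
    (m₀ : M) : E.SellerStrategy M where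
  offer w := decide (w.1 ≤ (s w.2.1 : ℝ))
  price _ := p
  message _ := m₀
  measurable_offer := by
    refine measurable_to_bool ?_
    have : (fun w : ℝ × E.SellerType × unitInterval => decide (w.1 ≤ (s w.2.1 : ℝ))) ⁻¹' {true} =
        {w | w.1 ≤ (s w.2.1 : ℝ)} := by
      ext w
      simp
    rw [this]
    exact measurableSet_le (by fun_prop) (Continuous.measurable (by fun_prop))
  measurable_price := measurable_const
  measurable_message := measurable_const

open Classical in
/-- Buyers accept prices that are weakly below a cutoff depending on their signal. -/
noncomputable def cutoffStrategy (M : Type*) [MeasurableSpace M] (V : E.X → ℝ) :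
    E.BuyerStrategy M where
  accept w := if (w.2.1 : ℝ) ≤ V w.1 then 1 else 0
  measurable_accept := by
    refine Measurable.ite ?_ measurable_const measurable_const
    exact measurableSet_le (by fun_prop)
      ((measurable_of_countable V).comp measurable_fst)

section Payoffs

variable {α : E.BuyerStrategy M} {p : E.Price} {s : E.SellerType → ℝ≥0} (hs : Continuous s) {m₀ : M}

theorem acceptProb_stopping (hReg : E.Regular) (β : E.BuyerStrategy M) (t : ℝ) (y : E.SellerType)
    (z : unitInterval) (ω : E.State) :
    acceptProb β (stoppingStrategy p hs m₀) t y z ω =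
      if t ≤ s y then ∑ x, E.sig x ω * (β.accept (x, p, m₀) : ℝ) else 0 := by
  simp only [acceptProb, stoppingStrategy, f_eq_sig hReg, decide_eq_true_eq]
  split_ifs <;> simp

variable (hα : ∀ x, (α.accept (x, p, m₀) : ℝ) = if x = E.xbar then 1 else 0)
include hα

theorem tradeRate_stopping (hReg : E.Regular) (t : ℝ) (y : E.SellerType)
    (z : unitInterval) (ω : E.State) :
    tradeRate α (stoppingStrategy p hs m₀) t y z ω = if t ≤ s y then E.hazard ω else 0 := by
  rw [tradeRate, acceptProb_stopping hs hReg]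
  simp [hα, hazard]

theorem survival_stopping (hReg : E.Regular) {t : ℝ} (ht : 0 ≤ t) {y : E.SellerType}
    (hty : t ≤ s y) (z : unitInterval) (ω : E.State) :
    survival α (stoppingStrategy p hs m₀) t y z ω = Real.exp (-(E.hazard ω * t)) := by
  have : ∫ r in (0 : ℝ)..t, tradeRate α (stoppingStrategy p hs m₀) r y z ω =
      ∫ r in (0 : ℝ)..t, E.hazard ω := by
    refine intervalIntegral.integral_congr fun r hr => ?_
    rw [Set.uIcc_of_le ht] at hr
    simp only [tradeRate_stopping hs hα hReg, if_pos (hr.2.trans hty)]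
  rw [survival, this]
  simp [mul_comm]

/-- The constant `c` stands for the flow payoff of either side. Beyond the exit time nothing is
offered, so the value does not depend on the horizon. -/
theorem integral_stopping (hReg : E.Regular) {H : ℝ} {y : E.SellerType} (hH : s y ≤ H)
    (z : unitInterval) (ω : E.State) (c : ℝ) :
    ∫ t in (0 : ℝ)..H, (if t ≤ s y then c else 0) * survival α (stoppingStrategy p hs m₀) t y z ω =
      c * ((1 - Real.exp (-(E.hazard ω * s y))) / E.hazard ω) := by
  have h1 := intervalIntegral_ite_le (s y).coe_nonneg hH
    (fun t => c * survival α (stoppingStrategy p hs m₀) t y z ω)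
  rw [← intervalIntegral_const_mul_exp_neg (hazard_pos ω)]
  refine Eq.trans ?_ (h1.trans ?_)
  · refine intervalIntegral.integral_congr fun t _ => ?_
    split_ifs <;> simp
  · refine intervalIntegral.integral_congr fun t ht => ?_
    rw [Set.uIcc_of_le (s y).coe_nonneg] at ht
    simp only [survival_stopping hs hα hReg ht.1 ht.2]

theorem sellerPayoff_stopping (hReg : E.Regular) {H : ℝ} (hH : ∀ y, s y ≤ H) :
    sellerPayoff α (stoppingStrategy p hs m₀) H = E.tradeIntegral (fun ω => (p : ℝ) - E.vS ω) s := by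
  rw [tradeIntegral_eq_offerTime (by fun_prop) hs, sellerPayoff]
  refine integral_congr_ae (Eventually.of_forall fun ω => ?_)
  simp only [offerTime]
  rw [← integral_const_mul, ← integral_const_mul]
  refine integral_congr_ae (Eventually.of_forall fun y => ?_)
  have hz : ∀ z : unitInterval, ∫ t in (0 : ℝ)..H,
      (((stoppingStrategy p hs m₀).price (t, y, z) : ℝ) - E.vS ω) *
        tradeRate α (stoppingStrategy p hs m₀) t y z ω *
        survival α (stoppingStrategy p hs m₀) t y z ω =
      ((p : ℝ) - E.vS ω) * E.hazard ω * ((1 - Real.exp (-(E.hazard ω * s y))) / E.hazard ω) := by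
    intro z
    rw [← integral_stopping hs hα hReg (hH y) z ω]
    refine intervalIntegral.integral_congr fun t _ => ?_
    simp only [tradeRate_stopping hs hα hReg, mul_ite, mul_zero]
    rfl
  simp only [hz]
  simp
  ring

/-- A single buyer's deviation leaves `survival` unchanged, and only acceptance at the offered price
and message matters. The payoff separates into one term per signal, linear in the acceptance
probability. -/
theorem buyerPayoff_stopping (h : E.Standing) (hpos : 0 < s E.highType) (β : E.BuyerStrategy M)
    {H : ℝ} (hH : ∀ y, s y ≤ H) :
    buyerPayoff α (stoppingStrategy p hs m₀) β H =
      ∑ x, (β.accept (x, p, m₀) : ℝ) *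
        ((E.passiveValue s x - p) * ∫ ω, E.sig x ω * E.offerTime s ω ∂E.μ) := by
  have hcont := continuous_offerTime hs
  have hstep : buyerPayoff α (stoppingStrategy p hs m₀) β H =
      ∫ ω, ∑ x, (β.accept (x, p, m₀) : ℝ) *
        ((E.vB ω - p) * (E.sig x ω * E.offerTime s ω)) ∂E.μ := by
    refine integral_congr_ae (Eventually.of_forall fun ω => ?_)
    have hR : ∑ x, (β.accept (x, p, m₀) : ℝ) * ((E.vB ω - p) * (E.sig x ω * E.offerTime s ω)) =
        ((E.vB ω - p) * ∑ x, E.sig x ω * (β.accept (x, p, m₀) : ℝ)) * E.offerTime s ω := by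
      rw [Finset.mul_sum, Finset.sum_mul]
      exact Finset.sum_congr rfl fun x _ => by ring
    simp only
    rw [hR, offerTime, ← integral_const_mul]
    refine integral_congr_ae (Eventually.of_forall fun y => ?_)
    have hz : ∀ z : unitInterval, ∫ t in (0 : ℝ)..H,
        (E.vB ω - ((stoppingStrategy p hs m₀).price (t, y, z) : ℝ)) *
          acceptProb β (stoppingStrategy p hs m₀) t y z ω *
          survival α (stoppingStrategy p hs m₀) t y z ω =
        ((E.vB ω - p) * ∑ x, E.sig x ω * (β.accept (x, p, m₀) : ℝ)) *
          ((1 - Real.exp (-(E.hazard ω * s y))) / E.hazard ω) := by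
      intro z
      rw [← integral_stopping hs hα h.reg (hH y) z ω]
      refine intervalIntegral.integral_congr fun t _ => ?_
      simp only [acceptProb_stopping hs h.reg, mul_ite, mul_zero]
      rfl
    simp only [hz]
    simp
    ring
  rw [hstep, integral_finsetSum _ fun x _ => Continuous.integrable_of_compactSpace (by fun_prop)]
  refine Finset.sum_congr rfl fun x _ => ?_
  rw [integral_const_mul, h.integral_value_sub_price hs hpos x p]

end Payoffs

end Market

/-! ### Assembling the equilibrium -/

theorem proposition7 (E : Market) (hTrade : E.TradeIsPossible) (hSupp : E.LowestStateInSupport)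
    (hReg : E.Regular) (M : Type*) [MeasurableSpace M] [Nonempty M] :
    ∃ (pstar : E.Price) (s : E.SellerType → ℝ≥0)
      (α : E.BuyerStrategy M) (S : E.SellerStrategy M),
      Market.IsEquilibrium α S ∧
      -- the seller offers the good exactly up to the exit time, at the single price `pstar`
      (∀ (t : ℝ) (y : E.SellerType) (z : unitInterval), 0 ≤ t →
        (S.offer (t, y, z) = true ↔ t ≤ (s y : ℝ)) ∧
        (S.offer (t, y, z) = true → S.price (t, y, z) = pstar)) ∧
      -- all types send the same message at all times
      (∃ m₀ : M, ∀ (t : ℝ) (y : E.SellerType) (z : unitInterval), 0 ≤ t →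
        S.message (t, y, z) = m₀) ∧
      -- the exit times
      (∃ y, s y ≠ 0) ∧ Continuous s ∧ Monotone s ∧
      (∀ y y' : E.SellerType, y < y' → s y ≠ 0 → s y < s y') ∧
      -- `pstar` is accepted by buyers with the highest signal only
      (∀ (x : E.X) (m : M), (α.accept (x, pstar, m) : ℝ) = if x = E.xbar then 1 else 0) ∧
      -- prices strictly above `pstar` are never accepted
      (∀ (x : E.X) (p : E.Price) (m : M), pstar < p → (α.accept (x, p, m) : ℝ) = 0) ∧
      -- a general price is accepted iff it is weakly below the passive-beliefs posterior value
      (∀ (x : E.X) (p : E.Price) (m : M), ((p : ℝ) ≤ E.passiveValue s x →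
          (α.accept (x, p, m) : ℝ) = 1) ∧
        (E.passiveValue s x < (p : ℝ) → (α.accept (x, p, m) : ℝ) = 0)) ∧
      -- the price is the buyers' value conditional on trade
      (pstar : ℝ) = E.meanGivenTrade E.vB s ∧
      -- the exit time is the first time at which the posterior of `pstar - vS` is nonpositive
      (∀ y : E.SellerType, IsLeast
        {r : ℝ≥0 | E.meanGivenTimeType (fun ω => (pstar : ℝ) - E.vS ω) (r : ℝ) y ≤ 0} (s y)) := by
  have h : E.Standing := ⟨hTrade, hSupp, hReg⟩
  obtain ⟨p, hp, hgain, hzero⟩ := h.exists_equilibrium_price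
  obtain ⟨m₀⟩ := ‹Nonempty M›
  have hs := h.continuous_exitTime hp
  have hpos := h.exitTime_pos_of_gain_pos hp hgain
  let pstar : E.Price := ⟨p, h.price_mem hs hpos hzero⟩
  have hps : (pstar : ℝ) = p := rfl
  set s := E.exitTime p with hsdef
  let α : E.BuyerStrategy M := Market.cutoffStrategy M (E.passiveValue s)
  have hV : ∀ x, E.passiveValue s x ≤ p := fun x => by
    by_cases hx : x = E.xbar
    · rw [hx, h.passiveValue_xbar hs hpos hzero]
    · exact (h.passiveValue_lt hs hpos hzero hx).le
  have hacc1 : ∀ (x : E.X) (q : E.Price) (m : M), (q : ℝ) ≤ E.passiveValue s x →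
      (α.accept (x, q, m) : ℝ) = 1 := fun x q m hq => by
    simp [α, Market.cutoffStrategy, hq]
  have hacc0 : ∀ (x : E.X) (q : E.Price) (m : M), E.passiveValue s x < (q : ℝ) →
      (α.accept (x, q, m) : ℝ) = 0 := fun x q m hq => by
    simp [α, Market.cutoffStrategy, not_le.mpr hq]
  have haccp : ∀ (x : E.X) (m : M),
      (α.accept (x, pstar, m) : ℝ) = if x = E.xbar then 1 else 0 := fun x m => by
    split_ifs with hx
    · exact hacc1 _ _ _ (by rw [hx, h.passiveValue_xbar hs hpos hzero])
    · exact hacc0 _ _ _ (h.passiveValue_lt hs hpos hzero hx)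
  have hrej : ∀ (x : E.X) (q : E.Price) (m : M), p < (q : ℝ) → (α.accept (x, q, m) : ℝ) = 0 :=
    fun x q m hq => hacc0 _ _ _ ((hV x).trans_lt hq)
  -- Once the horizon exceeds the exit time of the highest type, payoffs under the stopping strategy
  -- no longer change.
  have hlate : ∀ᶠ H : ℝ in atTop, ∀ y, s y ≤ H := by
    filter_upwards [eventually_ge_atTop (s E.highType : ℝ)] with H hH y
    exact (NNReal.coe_le_coe.mpr (h.monotone_exitTime hp (E.le_highType y))).trans hH
  refine ⟨pstar, s, α, Market.stoppingStrategy pstar hs m₀, ⟨?_, ?_⟩, ?_, ⟨m₀, fun _ _ _ _ => rfl⟩,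
    ⟨_, hpos.ne'⟩, hs, h.monotone_exitTime hp, fun y y' hy hne => h.exitTime_lt_of_lt hp hy hne,
    haccp, fun x q m hq => hrej x q m hq, fun x q m => ⟨hacc1 x q m, hacc0 x q m⟩,
    (h.meanGivenTrade_vB hs hpos hzero).symm, fun y => ?_⟩
  · refine ⟨E.tradeIntegral (fun ω => p - E.vS ω) s, ?_, fun σ => ?_⟩
    · refine tendsto_const_nhds.congr' ?_
      filter_upwards [hlate] with H hH
      exact (Market.sellerPayoff_stopping hs (fun x => haccp x m₀) hReg hH).symm
    · obtain ⟨u, hu⟩ := Market.exists_isSellerUtility α σ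
      refine ⟨u, hu, le_of_tendsto hu ?_⟩
      filter_upwards [eventually_ge_atTop 0] with H hH
      exact h.sellerPayoff_le hp hgain hrej σ hH
  · intro β ε hε
    filter_upwards [hlate] with H hH
    rw [Market.buyerPayoff_stopping hs (fun x => haccp x m₀) h hpos β hH,
      Market.buyerPayoff_stopping hs (fun x => haccp x m₀) h hpos α hH]
    -- No signal is worth more than the price, so no deviation earns a positive profit. The
    -- prescribed strategy earns exactly zero, because the only buyers who accept pay their
    -- posterior value.
    have h1 : ∑ x, (β.accept (x, pstar, m₀) : ℝ) * ((E.passiveValue s x - pstar) *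
        ∫ ω, E.sig x ω * E.offerTime s ω ∂E.μ) ≤ 0 :=
      Finset.sum_nonpos fun x _ => mul_nonpos_of_nonneg_of_nonpos (β.accept _).2.1
        (mul_nonpos_of_nonpos_of_nonneg (sub_nonpos.mpr (hV x))
          (h.integral_sig_offerTime_pos hs hpos x).le)
    have h2 : ∑ x, (α.accept (x, pstar, m₀) : ℝ) * ((E.passiveValue s x - pstar) *
        ∫ ω, E.sig x ω * E.offerTime s ω ∂E.μ) = 0 := by
      refine Finset.sum_eq_zero fun x _ => ?_
      rw [haccp]
      split_ifs with hx
      · rw [hx, h.passiveValue_xbar hs hpos hzero, hps, sub_self, zero_mul, mul_zero]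
      · rw [zero_mul]
    linarith
  · intro t y z _
    exact ⟨by simp [Market.stoppingStrategy], fun _ => rfl⟩
  · have := h.isLeast_exitTime hp y
    simpa only [hps, h.meanGivenTimeType_nonpos_iff] using this
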